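/- Let $G$ be a finite group. For $x=\sum_g n_g g\in\mathbb ZG$ write $\overline x=\sum_g n_g$, and apply $x\mapsto\overline x$ coefficientwise and entrywise to polynomials and matrices over $\mathbb ZG$ and $\mathbb ZG[t]$. A square matrix $A$ over $\mathbb ZG$ is *$G$-primitive* if its entries lie in $\mathbb Z_+G$ and, for some $p>0$, every coefficient $n_g$ of every entry of $A^p$ is positive; $\lambda_A$ denotes the spectral radius of the integer matrix $\overline A$. For a square matrix $B=\sum_{i=1}^{d}B_it^i$ over $t\,\mathbb ZG[t]$, where the $B_i$ are matrices over $\mathbb ZG$ and $d\ge 1$ is the largest degree of an entry, $B^{\Box}$ is the $d\times d$ block matrix over $\mathbb ZG$ with top block row $(B_1,\dots,B_d)$, identity blocks just below the diagonal, and zero blocks elsewhere. Square matrices $M,N$ of the same size over a ring $R$ are *$\mathrm{El}(R)$-equivalent* if $U(M\oplus I_j)V=N\oplus I_j$ for some $j$ and some products $U,V$ of basic elementary matrices over $R$ (matrices that differ from the identity in at most one off-diagonal entry). *Strong shift equivalence (SSE) over $\mathbb Z_+$* is the transitive relation on square matrices over $\mathbb Z_+$ generated by the pairs $(RS,SR)$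 with $R,S$ rectangular matrices over $\mathbb Z_+$. **Proposition 5.4.** Let $A$ be an $n\times n$ $G$-primitive matrix over $\mathbb Z_+G$ with $n>1$, let $1<\beta<\lambda_A$, and let $k\ge 0$ be an integer. Then there is a positive integer $r_0$ (depending on $A$, $\beta$ and $k$) such that the following holds. If $r\ge r_0$ and $Q$ is a $k\times k$ matrix over $\mathbb ZG[t]$ such that $I-Q\in \mathrm{GL}(k,\mathbb ZG[t])$ and (i) $|q_{ijsg}|\le\beta^s$ for all $i,j,s,g$, where $q_{ijsg}\in\mathbb Z$ is the coefficient of $g\,t^s$ in the $(i,j)$ entry of $Q$, and (ii) all entries of $Q$ lie in $t^r\,\mathbb ZG[t]$, then the matrix $\begin{pmatrix} I-Q&0\\0&I-tA\end{pmatrix}$ is $\mathrm{El}(\mathbb ZG[t])$-equivalent to a matrix $I-B$, where $B$ is an $(n+k)\times(n+k)$ matrix over $\mathbb ZG[t]$ such that (1) $B$ has all entries in $t\,\mathbb Z_+G[t]$, (2) $B^{\Box}$ is $G$-primitive, and (3) if $\overline Q=0$, then $\overline{B^{\Box}}$ is SSE over $\mathbb Z_+$ to $\overline A$. -/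

import Mathlib

open Polynomial

noncomputable section

namespace GExt

/-- The integral group ring `ℤG`. -/
abbrev ZG (G : Type*) : Type _ := MonoidAlgebra ℤ G

section Group

variable {G : Type*} [Group G]

/-- The augmentation `ℤG → ℤ`, `∑ n_g g ↦ ∑ n_g`. -/
def aug : ZG G →+* ℤ :=
  (MonoidAlgebra.lift ℤ ℤ G (1 : G →* ℤ)).toRingHom

theorem aug_apply (x : ZG G) : aug x = x.coeff.sum fun _ c => c := by
  simp [aug, MonoidAlgebra.lift_apply]

/-- The augmentation `ℤG[t] → ℤ[t]`, applied to each coefficient. -/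
def augPoly : (ZG G)[X] →+* ℤ[X] := Polynomial.mapRingHom aug

/-- `x ∈ ℤ₊G`: all integer coefficients are nonnegative. -/
def Nonneg (x : ZG G) : Prop := ∀ g, 0 ≤ x.coeff g

/-- `x ≫ 0`: the coefficient of every group element is positive. -/
def StrictlyPos (x : ZG G) : Prop := ∀ g, 0 < x.coeff g

/-- A square matrix over `ℤG` is `G`-primitive if its entries are in `ℤ₊G` and some positive
power has all entries `≫ 0`. -/
def GPrimitive {m : Type*} [Fintype m] [DecidableEq m] (A : Matrix m m (ZG G)) : Prop :=
  (∀ i j, Nonneg (A i j)) ∧ ∃ p : ℕ, 0 < p ∧ ∀ i j, StrictlyPos ((A ^ p) i j)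

/-- The spectral radius `λ_A` of a square matrix over `ℤG`: the largest modulus of a complex
eigenvalue of the integer matrix obtained by augmenting the entries. -/
def specRadius {m : Type*} [Fintype m] [DecidableEq m] (A : Matrix m m (ZG G)) : ℝ :=
  (spectralRadius ℂ (A.map fun x => ((aug x : ℤ) : ℂ))).toReal

/-- The entries of the matrix lie in `t ℤ₊G[t]`. -/
def OverTPos {m : Type*} (B : Matrix m m (ZG G)[X]) : Prop :=
  ∀ i j, (B i j).coeff 0 = 0 ∧ ∀ s, Nonneg ((B i j).coeff s)

end Group

section Ring

variable {R : Type*} [Ring R]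

/-- The matrix `tA` over `R[t]` of a matrix `A` over `R`. -/
def tMul {m : Type*} (A : Matrix m m R) : Matrix m m R[X] :=
  A.map (Polynomial.monomial 1)

/-- The largest degree of an entry of a polynomial matrix (and `1` if there is no entry of
positive degree). -/
def polyDegree {m : Type*} [Fintype m] (A : Matrix m m R[X]) : ℕ :=
  max 1 (Finset.univ.sup fun i => Finset.univ.sup fun j => (A i j).natDegree)

/-- The matrix `A^□` over `R` of a square matrix `A = A₁ t + ⋯ + A_d t^d` over `t R[t]`, `d` being
the largest degree of an entry: the `d × d` block matrix with top block row `A₁, …, A_d`, with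
identity blocks just below the diagonal, and with all other blocks zero. An index `(a, i)` stands
for the position `i` in the block number `a + 1`. -/
def box {m : Type*} [Fintype m] [DecidableEq m] (A : Matrix m m R[X]) :
    Matrix (Fin (polyDegree A) × m) (Fin (polyDegree A) × m) R :=
  Matrix.of fun x y =>
    if (x.1 : ℕ) = 0 then (A x.2 y.2).coeff ((y.1 : ℕ) + 1)
    else if (x.1 : ℕ) = (y.1 : ℕ) + 1 ∧ x.2 = y.2 then 1 else 0

/-- The products of basic elementary matrices `1 + r E_{ij}`, `i ≠ j`. This is closed under
inverses, as `1 + r E_{ij}` has the inverse `1 + (-r) E_{ij}`. -/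
def El (m : Type*) [Fintype m] [DecidableEq m] (R : Type*) [Ring R] : Submonoid (Matrix m m R) :=
  Submonoid.closure {U | ∃ i j : m, i ≠ j ∧ ∃ r : R, U = 1 + Matrix.single i j r}

/-- `El(R)` equivalence of two square matrices `M`, `N` of the same size:
`U (M ⊕ I_j) V = N ⊕ I_j` for some `j` and some products `U`, `V` of basic elementary matrices. -/
def ElEquiv {m : Type*} [Fintype m] [DecidableEq m] (M N : Matrix m m R) : Prop :=
  ∃ j : ℕ, ∃ U ∈ El (m ⊕ Fin j) R, ∃ V ∈ El (m ⊕ Fin j) R,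
    U * Matrix.fromBlocks M 0 0 1 * V = Matrix.fromBlocks N 0 0 1

/-- Strong shift equivalence over a set `S` of scalars: the transitive relation, between square
matrices of possibly different sizes, generated by the pairs `(U V, V U)` with `U`, `V`
(rectangular) matrices over `S`. -/
inductive SSE (S : Set R) :
    ∀ {m n : Type} [Fintype m] [Fintype n], Matrix m m R → Matrix n n R → Prop
  | elementary {m n : Type} [Fintype m] [Fintype n] (U : Matrix m n R) (V : Matrix n m R)
      (hU : ∀ i j, U i j ∈ S) (hV : ∀ i j, V i j ∈ S) : SSE S (U * V) (V * U)
  | trans {l m n : Type} [Fintype l] [Fintype m] [Fintype n]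
      {A : Matrix l l R} {B : Matrix m m R} {C : Matrix n n R} :
      SSE S A B → SSE S B C → SSE S A C

end Ring

end GExt

end

/-! Read a matrix over `t ℤ₊G[t]` as a weighted graph in which a term `g t^s` is an edge of length
`s`. The signed block `Q` is absorbed into the positive block, whose path counts grow faster than
`β^s`.

Row operations turn `tA` into `A' = expandRow A i₀ q` (`exists_El_expandRow`): here `i₀` carries
first-return loops of many lengths, and is left for other vertices only by edges of length `q + 1`.
Split off `k` loop terms `g_a t^(s_a + 1)`, so that `A' = S Y + C` with `S` constant and `Y`
concentrated in column `i₀`. As `1 - Q` is invertible, elementary operations (`ElEquiv.of_blocks`)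
produce a matrix with `k` extra rows, which still depends on a free multiplier `ρ`. For the full
series `ρ = (1 - Q) Y (1 - C)⁻¹`, which counts paths in `C` after an initial edge of `(1 - Q) Y`,
the upper right block would vanish. Its truncation `truncPaths` leaves there only terms of high
degree, and these are nonnegative if the series is.

Row `a` of `(1 - Q) Y` is `g_a t^(s_a + 1)` plus signed terms of degree greater than `r`. The closed
path counts of `C` at `i₀` have coefficients at least `γ^m` for some `γ > β`
(`GPrimitive.exists_growth`, `le_coeff_pathSum`), and path counts are supermultiplicative
(`pathSum_mul_le`). Hence the contribution of `Q` is at most the leading one times a tail of a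
geometric series in `β / γ`, and for large `r` at least half of the leading one survives
(`half_le_coeff_pathConv`). That half also dominates the coefficients of `Q` in the upper left
block.

The truncation is arranged so that the top degree occurs in every entry of the extra rows. Together
with strictly positive loops of lengths `r` and `r + 1`, this makes the box primitive
(`gprimitive_boxL`).

If `Q` augments to zero, the augmented moves are strong shift equivalences: path expansions,
performed one degree at a time (`sse_boxL_expand`), and a commutation of `S` past the remaining
factor (`sse_boxL_mul_comm`); `sse_pathBlocks` assembles them. -/

noncomputable section

namespace GExt

/-! ### Elementary matrices and the basic block transformation. -/

section Elementary

variable {m n : Type*} [Fintype m] [DecidableEq m] [Fintype n] [DecidableEq n]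
  {R : Type*} [Ring R]

/-- No two nonzero entries of `D` can be composed, so all products of two terms `D i j E_ij` vanish
and `1 + D` is the product of the factors `1 + D i j E_ij`. -/
theorem one_add_mem_El (p : m → Prop) (D : Matrix m m R)
    (hD : ∀ i j, D i j ≠ 0 → p i ∧ ¬ p j) : 1 + D ∈ El m R := by
  have key : ∀ T : Finset (m × m),
      1 + ∑ x ∈ T, Matrix.single x.1 x.2 (D x.1 x.2) ∈ El m R := by
    intro T
    induction T using Finset.induction_on with
    | empty => simp
    | insert x T hx ih =>
      rw [Finset.sum_insert hx]
      by_cases h0 : D x.1 x.2 = 0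
      · simpa [h0] using ih
      have hz : Matrix.single x.1 x.2 (D x.1 x.2) *
          ∑ y ∈ T, Matrix.single y.1 y.2 (D y.1 y.2) = 0 := by
        rw [Finset.mul_sum]
        refine Finset.sum_eq_zero fun y _ => ?_
        by_cases h1 : D y.1 y.2 = 0
        · simp [h1]
        · have hne : x.2 ≠ y.1 := fun h => (hD _ _ h0).2 (by rw [h]; exact (hD _ _ h1).1)
          exact Matrix.single_mul_single_of_ne _ _ _ _ hne _
      have : 1 + (Matrix.single x.1 x.2 (D x.1 x.2) +
          ∑ y ∈ T, Matrix.single y.1 y.2 (D y.1 y.2)) =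
          (1 + Matrix.single x.1 x.2 (D x.1 x.2)) *
            (1 + ∑ y ∈ T, Matrix.single y.1 y.2 (D y.1 y.2)) := by
        rw [add_mul, mul_add, mul_add, hz]
        simp only [add_zero, mul_one, one_mul]
        abel
      rw [this]
      refine (El m R).mul_mem (Submonoid.subset_closure ⟨x.1, x.2, ?_, _, rfl⟩) ih
      intro h
      exact (hD _ _ h0).2 (h ▸ (hD _ _ h0).1)
  have h := key Finset.univ
  rw [← Finset.univ_product_univ, Finset.sum_product] at h
  have h2 : D = ∑ i, ∑ j, Matrix.single i j (D i j) := Matrix.matrix_eq_sum_single D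
  rw [h2]
  exact h

theorem fromBlocks_one_left_mem_El {U : Matrix n n R} (hU : U ∈ El n R) :
    Matrix.fromBlocks (1 : Matrix m m R) 0 0 U ∈ El (m ⊕ n) R := by
  induction hU using Submonoid.closure_induction with
  | mem U h =>
    obtain ⟨i, j, hij, r, rfl⟩ := h
    refine Submonoid.subset_closure ⟨Sum.inr i, Sum.inr j, by simpa using hij, r, ?_⟩
    rw [← Matrix.fromBlocks_one]
    ext (a | a) (b | b) <;> simp [Matrix.single_apply, Matrix.one_apply]
  | one => simp
  | mul U V _ _ h1 h2 =>
    have := (El (m ⊕ n) R).mul_mem h1 h2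
    simpa [Matrix.fromBlocks_multiply] using this

theorem fromBlocks_one_right_mem_El {U : Matrix m m R} (hU : U ∈ El m R) :
    Matrix.fromBlocks U 0 0 (1 : Matrix n n R) ∈ El (m ⊕ n) R := by
  induction hU using Submonoid.closure_induction with
  | mem U h =>
    obtain ⟨i, j, hij, r, rfl⟩ := h
    refine Submonoid.subset_closure ⟨Sum.inl i, Sum.inl j, by simpa using hij, r, ?_⟩
    rw [← Matrix.fromBlocks_one]
    ext (a | a) (b | b) <;> simp [Matrix.single_apply, Matrix.one_apply]
  | one => simp
  | mul U V _ _ h1 h2 =>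
    have := (El (m ⊕ n) R).mul_mem h1 h2
    simpa [Matrix.fromBlocks_multiply] using this

theorem fromBlocks_upper_mem_El (X : Matrix m n R) :
    Matrix.fromBlocks (1 : Matrix m m R) X 0 (1 : Matrix n n R) ∈ El (m ⊕ n) R := by
  have : Matrix.fromBlocks (1 : Matrix m m R) X 0 (1 : Matrix n n R) =
      1 + Matrix.fromBlocks (0 : Matrix m m R) X 0 0 := by
    rw [← Matrix.fromBlocks_one, Matrix.fromBlocks_add]; simp
  rw [this]
  apply one_add_mem_El (fun x => x.isLeft = true)
  rintro (i | i) (j | j) h <;> simp at h ⊢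

theorem fromBlocks_lower_mem_El (X : Matrix n m R) :
    Matrix.fromBlocks (1 : Matrix m m R) 0 X (1 : Matrix n n R) ∈ El (m ⊕ n) R := by
  have : Matrix.fromBlocks (1 : Matrix m m R) 0 X (1 : Matrix n n R) =
      1 + Matrix.fromBlocks (0 : Matrix m m R) 0 X 0 := by
    rw [← Matrix.fromBlocks_one, Matrix.fromBlocks_add]; simp
  rw [this]
  apply one_add_mem_El (fun x => x.isRight = true)
  rintro (i | i) (j | j) h <;> simp at h ⊢

theorem ElEquiv.of_mul {M N U V : Matrix m m R} (hU : U ∈ El m R) (hV : V ∈ El m R)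
    (h : U * M * V = N) : ElEquiv M N := by
  refine ⟨0, _, fromBlocks_one_right_mem_El hU, _, fromBlocks_one_right_mem_El hV, ?_⟩
  simp [Matrix.fromBlocks_multiply, h]

/-- Let `P` be an inverse of `1 - Q`, and `C = A' - S Y`. -/
theorem ElEquiv.of_blocks {Q P : Matrix m m R} {A A' C E : Matrix n n R} (hE : E ∈ El n R)
    (hA : E * (1 - A) = 1 - A') (hP : P * (1 - Q) = 1) (Y ρ : Matrix m n R) (S : Matrix n m R)
    (hC : C = A' - S * Y) :
    ElEquiv (Matrix.fromBlocks (1 - Q) 0 0 (1 - A))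
      (1 - Matrix.fromBlocks (Q + ((1 - Q) * Y + ρ * C) * S) ((1 - Q) * Y - ρ * (1 - C))
        (C * S) C) := by
  -- On the left, `S P` creates the block `-S` out of `1 - Q`, and `ρ` adds multiples of the lower
  -- rows to the upper ones. On the right, `-Y` changes `A'` into `C`, and the last factor changes
  -- the lower left block `-S` into `-C S`.
  refine ElEquiv.of_mul
    (U := Matrix.fromBlocks 1 ρ 0 1 * (Matrix.fromBlocks 1 0 (-(S * P)) 1 *
      Matrix.fromBlocks 1 0 0 E))
    (V := Matrix.fromBlocks 1 (-Y) 0 1 * Matrix.fromBlocks 1 0 S 1)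
    ?_ ?_ ?_
  · exact mul_mem (fromBlocks_upper_mem_El _)
      (mul_mem (fromBlocks_lower_mem_El _) (fromBlocks_one_left_mem_El hE))
  · exact mul_mem (fromBlocks_upper_mem_El _) (fromBlocks_lower_mem_El _)
  · have e1 : -(S * P) * (1 - Q) = -S := by rw [Matrix.neg_mul, Matrix.mul_assoc, hP, Matrix.mul_one]
    have hR : (1 : Matrix (m ⊕ n) (m ⊕ n) R) -
        Matrix.fromBlocks (Q + ((1 - Q) * Y + ρ * C) * S) ((1 - Q) * Y - ρ * (1 - C)) (C * S) C =
        Matrix.fromBlocks (1 - (Q + ((1 - Q) * Y + ρ * C) * S)) (-((1 - Q) * Y - ρ * (1 - C)))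
          (-(C * S)) (1 - C) := by
      rw [← Matrix.fromBlocks_one, sub_eq_add_neg, Matrix.fromBlocks_neg, Matrix.fromBlocks_add]
      simp [sub_eq_add_neg]
    rw [hR]
    have step1 : Matrix.fromBlocks 1 0 (-(S * P)) 1 * Matrix.fromBlocks 1 0 0 E *
        Matrix.fromBlocks (1 - Q) 0 0 (1 - A) =
        Matrix.fromBlocks (1 - Q) 0 (-S) (1 - A') := by
      simp only [Matrix.fromBlocks_multiply, Matrix.one_mul, Matrix.mul_one, Matrix.zero_mul,
        Matrix.mul_zero, add_zero, zero_add, e1, hA]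
    have step2 : Matrix.fromBlocks (1 - Q) 0 (-S) (1 - A') * Matrix.fromBlocks 1 (-Y) 0 1 =
        Matrix.fromBlocks (1 - Q) (-((1 - Q) * Y)) (-S) (1 - C) := by
      simp only [Matrix.fromBlocks_multiply, Matrix.one_mul, Matrix.mul_one, Matrix.zero_mul,
        Matrix.mul_zero, add_zero, zero_add, hC, Matrix.mul_neg, Matrix.neg_mul, neg_neg]
      congr 1; abel
    rw [Matrix.mul_assoc (Matrix.fromBlocks 1 ρ 0 1), step1,
      ← Matrix.mul_assoc (_ * _), Matrix.mul_assoc (Matrix.fromBlocks 1 ρ 0 1), step2]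
    simp only [Matrix.fromBlocks_multiply, Matrix.one_mul, Matrix.mul_one, Matrix.zero_mul,
      Matrix.mul_zero, add_zero, zero_add]
    congr 1
    · simp only [Matrix.add_mul, Matrix.sub_mul, Matrix.mul_sub, Matrix.mul_neg, Matrix.neg_mul,
        Matrix.one_mul, Matrix.mul_one, Matrix.mul_assoc]
      abel
    · abel
    · simp only [Matrix.add_mul, Matrix.sub_mul, Matrix.mul_sub, Matrix.mul_neg, Matrix.neg_mul,
        Matrix.one_mul, Matrix.mul_one, Matrix.mul_assoc]
      abel

end Elementary

/-! ### Strong shift equivalences between box matrices over `ℤ₊`. -/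

section StrongShift

/-- The block matrix defining `box B`, with `L` blocks. -/
def boxL {R : Type*} [Ring R] {m : Type*} [DecidableEq m] (L : ℕ) (B : Matrix m m R[X]) :
    Matrix (Fin L × m) (Fin L × m) R :=
  Matrix.of fun x y =>
    if (x.1 : ℕ) = 0 then (B x.2 y.2).coeff ((y.1 : ℕ) + 1)
    else if (x.1 : ℕ) = (y.1 : ℕ) + 1 ∧ x.2 = y.2 then 1 else 0

theorem box_eq_boxL {R : Type*} [Ring R] {m : Type*} [Fintype m] [DecidableEq m]
    (B : Matrix m m R[X]) : box B = boxL (polyDegree B) B := rfl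

theorem SSE.mul_comm' {m n : Type} [Fintype m] [Fintype n] {M : Matrix m m ℤ} {N : Matrix n n ℤ}
    (U : Matrix m n ℤ) (V : Matrix n m ℤ) (hU : ∀ i j, 0 ≤ U i j) (hV : ∀ i j, 0 ≤ V i j)
    (hM : U * V = M) (hN : V * U = N) : SSE {x : ℤ | 0 ≤ x} M N := by
  subst hM hN
  exact SSE.elementary U V hU hV

theorem SSE.refl' {m : Type} [Fintype m] (M : Matrix m m ℤ) (hM : ∀ i j, 0 ≤ M i j) :
    SSE {x : ℤ | 0 ≤ x} M M := by
  classical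
  refine SSE.mul_comm' 1 M (fun i j => ?_) hM (by simp) (by simp)
  rw [Matrix.one_apply]; split_ifs <;> simp

theorem SSE.symm' {m n : Type} [Fintype m] [Fintype n] {M : Matrix m m ℤ} {N : Matrix n n ℤ}
    (h : SSE {x : ℤ | 0 ≤ x} M N) : SSE {x : ℤ | 0 ≤ x} N M := by
  induction h with
  | elementary U V hU hV => exact SSE.elementary V U hV hU
  | trans _ _ h1 h2 => exact SSE.trans h2 h1

/-- Rows and columns at indices whose columns vanish can be deleted. -/
theorem SSE.submatrix {m n : Type} [Fintype m] [Fintype n] (M : Matrix m m ℤ)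
    (hM : ∀ i j, 0 ≤ M i j) (φ : n → m) (hφ : Function.Injective φ)
    (h0 : ∀ i j, j ∉ Set.range φ → M i j = 0) :
    SSE {x : ℤ | 0 ≤ x} M (M.submatrix φ φ) := by
  classical
  refine SSE.mul_comm' (M.submatrix id φ) (Matrix.of fun a j => if φ a = j then 1 else 0)
    (fun i j => hM _ _) (fun i j => ?_) ?_ ?_
  · simp only [Matrix.of_apply]; split_ifs <;> simp
  · ext i j
    simp only [Matrix.mul_apply, Matrix.submatrix_apply, id, Matrix.of_apply, mul_ite, mul_one,
      mul_zero]
    by_cases hj : j ∈ Set.range φ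
    · obtain ⟨a, rfl⟩ := hj
      simp [hφ.eq_iff]
    · rw [h0 i j hj]
      refine Finset.sum_eq_zero fun a _ => if_neg fun h => hj ⟨a, h⟩
  · ext i j
    simp [Matrix.mul_apply]

/-- Factor `K + X W` as `(K X)` times the column `(1; W)`. The reversed product has blocks `K`, `X`,
`W K`, `W X`, hence is again of the form `K' + X' W'` with the index of `W` lowered by one. After
`s` such steps both sides depend only on the common value `W 0 = W' 0`, and the second chain is run
backwards. -/
theorem sse_chain (s : ℕ) : ∀ {a p : Type} [Fintype a] [Fintype p]
    (K : Matrix a a ℤ) (X : Matrix a p ℤ) (W W' : ℕ → Matrix p a ℤ),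
    (∀ i j, 0 ≤ K i j) → (∀ i j, 0 ≤ X i j) → (∀ e i j, 0 ≤ W e i j) → (∀ e i j, 0 ≤ W' e i j) →
    (∀ e < s, W (e + 1) * K = W e) → (∀ e < s, W (e + 1) * X = 0) →
    (∀ e < s, W' (e + 1) * K = W' e) → (∀ e < s, W' (e + 1) * X = 0) →
    W 0 = W' 0 → SSE {x : ℤ | 0 ≤ x} (K + X * W s) (K + X * W' s) := by
  classical
  induction s with
  | zero =>
    intro a p _ _ K X W W' hK hX hW _ _ _ _ _ h0
    rw [h0]
    refine SSE.refl' _ fun i j => add_nonneg (hK i j) ?_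
    rw [Matrix.mul_apply, ← h0]
    exact Finset.sum_nonneg fun l _ => mul_nonneg (hX i l) (hW 0 l j)
  | succ s ih =>
    intro a p _ _ K X W W' hK hX hW hW' h1 h2 h3 h4 h0
    have step : ∀ V : ℕ → Matrix p a ℤ, (∀ e i j, 0 ≤ V e i j) →
        (∀ e < s + 1, V (e + 1) * K = V e) → (∀ e < s + 1, V (e + 1) * X = 0) →
        SSE {x : ℤ | 0 ≤ x} (K + X * V (s + 1))
          (Matrix.fromBlocks K X 0 0 +
            Matrix.fromRows (0 : Matrix a p ℤ) 1 * Matrix.fromCols (V s) 0) := by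
      intro V hV hV1 hV2
      refine SSE.mul_comm' (Matrix.fromCols K X) (Matrix.fromRows 1 (V (s + 1))) ?_ ?_ ?_ ?_
      · rintro i (j | j)
        · exact hK i j
        · exact hX i j
      · rintro (i | i) j
        · rw [Matrix.fromRows_apply_inl, Matrix.one_apply]
          split_ifs <;> simp
        · exact hV _ i j
      · rw [Matrix.fromCols_mul_fromRows, Matrix.mul_one]
      · rw [Matrix.fromRows_mul_fromCols, Matrix.fromRows_mul_fromCols, Matrix.fromBlocks_add,
          hV1 s (Nat.lt_succ_self s), hV2 s (Nat.lt_succ_self s)]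
        simp
    refine (step W hW h1 h2).trans (SSE.trans ?_ (step W' hW' h3 h4).symm')
    refine ih (Matrix.fromBlocks K X 0 0) (Matrix.fromRows 0 1)
      (fun e => Matrix.fromCols (W e) 0) (fun e => Matrix.fromCols (W' e) 0) ?_ ?_ ?_ ?_ ?_ ?_ ?_ ?_
      (by rw [h0])
    · rintro (i | i) (j | j)
      · exact hK i j
      · exact hX i j
      · simp
      · simp
    · rintro (i | i) j
      · simp
      · simp only [Matrix.fromRows_apply_inr, Matrix.one_apply]
        split_ifs <;> simp
    · rintro e i (j | j)
      · exact hW _ _ _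
      · simp
    · rintro e i (j | j)
      · exact hW' _ _ _
      · simp
    · intro e he
      rw [Matrix.fromCols_mul_fromBlocks, h1 e (by omega), h2 e (by omega)]
      simp
    · intro e he
      rw [Matrix.fromCols_mul_fromRows]; simp
    · intro e he
      rw [Matrix.fromCols_mul_fromBlocks, h3 e (by omega), h4 e (by omega)]
      simp
    · intro e he
      rw [Matrix.fromCols_mul_fromRows]; simp

variable {m : Type} [Fintype m] [DecidableEq m]

theorem boxL_nonneg {m : Type} [DecidableEq m] (L : ℕ) (B : Matrix m m ℤ[X])
    (hB : ∀ i j e, 0 ≤ (B i j).coeff e) (x y) :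
    0 ≤ boxL L B x y := by
  simp only [boxL, Matrix.of_apply]
  split_ifs
  · exact hB _ _ _
  · simp
  · simp

/-- The last block is entered only through the coefficient of `t^(L + 1)`, so here its columns
vanish. -/
theorem sse_boxL_succ (L : ℕ) (B : Matrix m m ℤ[X]) (hB : ∀ i j e, 0 ≤ (B i j).coeff e)
    (h : ∀ i j, (B i j).coeff (L + 1) = 0) :
    SSE {x : ℤ | 0 ≤ x} (boxL (L + 1) B) (boxL L B) := by
  have := SSE.submatrix (boxL (L + 1) B) (boxL_nonneg _ B hB)
    (fun x : Fin L × m => (x.1.castSucc, x.2))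
    (fun x y hxy => by
      simp only [Prod.mk.injEq, Fin.castSucc_inj] at hxy
      exact Prod.ext hxy.1 hxy.2)
    (fun x y hy => by
      have hy1 : y.1 = Fin.last L := by
        by_contra hne
        exact hy ⟨(y.1.castPred hne, y.2), by simp⟩
      simp only [boxL, Matrix.of_apply, hy1, Fin.val_last, h]
      have : (x.1 : ℕ) ≠ L + 1 := by have := x.1.2; omega
      simp [this])
  have h2 : boxL L B = (boxL (L + 1) B).submatrix (fun x : Fin L × m => (x.1.castSucc, x.2))
      (fun x : Fin L × m => (x.1.castSucc, x.2)) := by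
    ext x y
    simp only [boxL, Matrix.of_apply, Matrix.submatrix_apply, Fin.val_castSucc]
  rwa [h2]

theorem sse_boxL_le (L L' : ℕ) (hL : L ≤ L') (B : Matrix m m ℤ[X])
    (hB : ∀ i j e, 0 ≤ (B i j).coeff e) (h : ∀ i j e, L < e → (B i j).coeff e = 0) :
    SSE {x : ℤ | 0 ≤ x} (boxL L' B) (boxL L B) := by
  induction L', hL using Nat.le_induction with
  | base => exact SSE.refl' _ (boxL_nonneg _ B hB)
  | succ L' hL ih => exact (sse_boxL_succ L' B hB fun i j => h i j _ (by omega)).trans ih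

/-- Replacing the edges given by `t ^ s D` with paths that continue by an edge of `C`. -/
theorem sse_boxL_expand (L s : ℕ) (hs : 1 ≤ s) (hsL : s ≤ L) (C : Matrix m m ℤ[X])
    (D : Matrix m m ℤ) (p : m → Prop) (hC : ∀ i j e, 0 ≤ (C i j).coeff e)
    (hC0 : ∀ i j, (C i j).coeff 0 = 0) (hD : ∀ i j, 0 ≤ D i j)
    (hp : ∀ i j, D i j ≠ 0 → ¬ p i ∧ p j)
    (hdeg : ∀ i j e, L < s + e → (C i j).coeff e = 0) :
    SSE {x : ℤ | 0 ≤ x} (boxL L (C + D.map (monomial s)))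
      (boxL L (C + D.map (monomial s) * C)) := by
  classical
  -- After an edge of `D` there remain `s - 1` waiting steps and then an edge of `C`. `W e` waits
  -- first, in block `e - 1` over `j`. `W' e` takes the edge of `C` at once and lengthens it by `e`;
  -- the truncated subtraction is harmless because `C` has no constant term. The two agree at `e =
  -- 0`, and `hdeg` ensures that the lengthened edges fit into `L` blocks.
  let X : Matrix (Fin L × m) m ℤ := Matrix.of fun x j => if (x.1 : ℕ) = 0 then D x.2 j else 0
  let W' : ℕ → Matrix m (Fin L × m) ℤ := fun e => Matrix.of fun j y =>
    if p j then (C j y.2).coeff ((y.1 : ℕ) + 1 - e) else 0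
  let W : ℕ → Matrix m (Fin L × m) ℤ := fun e => if e = 0 then W' 0 else
    Matrix.of fun j y => if p j ∧ (y.1 : ℕ) + 1 = e ∧ j = y.2 then 1 else 0
  have key := sse_chain s (boxL L C) X W W' (boxL_nonneg L C hC) ?_ ?_ ?_ ?_ ?_ ?_ ?_ rfl
  · convert key using 1
    · ext x y
      simp only [Matrix.add_apply, boxL, Matrix.of_apply, Matrix.mul_apply, X, W,
        show s ≠ 0 by omega, if_false, Matrix.map_apply, coeff_add]
      split_ifs with h1 h2
      · congr 1
        rw [coeff_monomial]
        by_cases h3 : s = (y.1 : ℕ) + 1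
        · rw [if_pos h3]
          rw [Finset.sum_eq_single y.2]
          · by_cases h4 : D x.2 y.2 = 0
            · simp [h4]
            · simp [(hp _ _ h4).2, h3]
          · intro b _ hb
            simp [hb]
          · simp
        · rw [if_neg h3]
          symm
          apply Finset.sum_eq_zero
          intro b _
          rw [if_neg (by rintro ⟨_, h, _⟩; exact h3 h.symm), mul_zero]
      · simp
      · simp
    · ext x y
      simp only [Matrix.add_apply, boxL, Matrix.of_apply, Matrix.mul_apply, X, W',
        Matrix.map_apply, coeff_add]
      split_ifs with h1 h2
      · congr 1
        rw [finsetSum_coeff]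
        refine Finset.sum_congr rfl fun l _ => ?_
        rw [← C_mul_X_pow_eq_monomial, mul_assoc, coeff_C_mul, coeff_X_pow_mul']
        by_cases h4 : D x.2 l = 0
        · simp [h4]
        · rw [if_pos (hp _ _ h4).2]
          congr 1
          split_ifs with h5
          · rfl
          · rw [Nat.sub_eq_zero_of_le (by omega), hC0]
      · simp
      · simp
  · intro x j
    simp only [X, Matrix.of_apply]
    split_ifs
    · exact hD _ _
    · exact le_rfl
  · intro e j y
    simp only [W]
    split_ifs
    · simp only [W', Matrix.of_apply]
      split_ifs
      · exact hC _ _ _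
      · exact le_rfl
    · simp only [Matrix.of_apply]
      split_ifs <;> simp
  · intro e j y
    simp only [W', Matrix.of_apply]
    split_ifs
    · exact hC _ _ _
    · exact le_rfl
  · intro e he
    ext j y
    simp only [W, Nat.succ_ne_zero, if_false, Matrix.mul_apply, Matrix.of_apply]
    rw [Finset.sum_eq_single (⟨e, by omega⟩, j)]
    · by_cases hpj : p j
      · by_cases he0 : e = 0
        · subst he0
          simp [hpj, boxL, W']
        · simp only [hpj, boxL, he0, true_and, if_true, if_false, Matrix.of_apply,
            one_mul]
          congr 1
          simp [eq_comm]
      · by_cases he0 : e = 0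
        · subst he0
          simp [hpj, W']
        · simp [hpj, he0]
    · intro x _ hx
      rw [if_neg, zero_mul]
      rintro ⟨_, h1, h2⟩
      exact hx (Prod.ext (Fin.ext (by simpa using h1)) h2.symm)
    · simp
  · intro e he
    ext j l
    simp only [W, X, Nat.succ_ne_zero, if_false, Matrix.mul_apply, Matrix.of_apply,
      Matrix.zero_apply]
    refine Finset.sum_eq_zero fun x _ => ?_
    split_ifs with h1 h2
    · by_contra h3
      have := (hp x.2 l (by simpa using h3)).1
      exact this (h1.2.2 ▸ h1.1)
    all_goals simp
  · intro e he
    ext j y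
    simp only [W', Matrix.mul_apply, Matrix.of_apply]
    by_cases hpj : p j
    swap
    · simp [hpj]
    simp only [hpj, if_true]
    by_cases hy : (y.1 : ℕ) + 1 < L
    · rw [Finset.sum_eq_single (⟨(y.1 : ℕ) + 1, hy⟩, y.2)]
      · simp [boxL]
      · intro x _ hx
        by_cases hx0 : (x.1 : ℕ) = 0
        · rw [hx0, Nat.sub_eq_zero_of_le (by omega), hC0, zero_mul]
        · simp only [boxL, Matrix.of_apply, hx0, if_false]
          rw [if_neg, mul_zero]
          rintro ⟨h1, h2⟩
          exact hx (Prod.ext (Fin.ext (by simpa using h1)) h2)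
      · simp
    · have hyL : (y.1 : ℕ) + 1 = L := by have := y.1.2; omega
      rw [hdeg j y.2 _ (by omega)]
      refine Finset.sum_eq_zero fun x _ => ?_
      by_cases hx0 : (x.1 : ℕ) = 0
      · rw [hx0, Nat.sub_eq_zero_of_le (by omega), hC0, zero_mul]
      · simp only [boxL, Matrix.of_apply, hx0, if_false]
        rw [if_neg, mul_zero]
        rintro ⟨h1, h2⟩
        have := x.1.2
        omega
  · intro e he
    ext j l
    simp only [W', X, Matrix.mul_apply, Matrix.of_apply, Matrix.zero_apply]
    refine Finset.sum_eq_zero fun x _ => ?_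
    by_cases hx0 : (x.1 : ℕ) = 0
    · rw [hx0, Nat.sub_eq_zero_of_le (by omega), hC0]
      simp
    · simp [hx0]

/-- Strong shift equivalence of `S T` and `T S` for a constant matrix `S`. -/
theorem sse_boxL_mul_comm (L : ℕ) (T : Matrix m m ℤ[X]) (S : Matrix m m ℤ)
    (hT : ∀ i j e, 0 ≤ (T i j).coeff e) (hS : ∀ i j, 0 ≤ S i j) :
    SSE {x : ℤ | 0 ≤ x} (boxL L (S.map Polynomial.C * T)) (boxL L (T * S.map Polynomial.C)) := by
  let co : ℕ → Matrix m m ℤ := fun e => T.map fun q => q.coeff e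
  -- `V i` applies `S` in block `i` only, and `U i` is the box of `T` with `S` already applied to
  -- the top blocks of index below `i`. Since `U i * V i = V (i + 1) * U (i + 1)`, the factor `S`
  -- moves along by one block per step: it stands to the left of `T` at `i = 0`, and to the right at
  -- `i = L + 1`.
  let U : ℕ → Matrix (Fin L × m) (Fin L × m) ℤ := fun i => Matrix.of fun x y =>
    if (x.1 : ℕ) = 0 then (if (y.1 : ℕ) < i then (co (y.1 + 1) * S) x.2 y.2
      else co (y.1 + 1) x.2 y.2)
    else if (x.1 : ℕ) = (y.1 : ℕ) + 1 ∧ x.2 = y.2 then 1 else 0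
  let V : ℕ → Matrix (Fin L × m) (Fin L × m) ℤ := fun i => Matrix.of fun x y =>
    if x.1 = y.1 then (if (x.1 : ℕ) = i then S x.2 y.2 else if x.2 = y.2 then 1 else 0) else 0
  have hUV : ∀ i x y, (U i * V i) x y = if (x.1 : ℕ) = 0 then
      (if (y.1 : ℕ) < i + 1 then (co (y.1 + 1) * S) x.2 y.2 else co (y.1 + 1) x.2 y.2)
      else if (x.1 : ℕ) = (y.1 : ℕ) + 1 then
        (if (y.1 : ℕ) = i then S x.2 y.2 else if x.2 = y.2 then 1 else 0) else 0 := by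
    intro i x y
    simp only [Matrix.mul_apply, U, V, Matrix.of_apply, Fintype.sum_prod_type]
    rw [Finset.sum_eq_single y.1 (by intro b _ hb; simp [hb]) (by simp)]
    by_cases hx : (x.1 : ℕ) = 0
    · simp only [hx, if_true]
      by_cases hy : (y.1 : ℕ) = i
      · simp [hy, co]
      · simp only [hy, if_false, mul_ite, mul_one, mul_zero, Finset.sum_ite_eq', Finset.mem_univ,
          if_true]
        by_cases h : (y.1 : ℕ) < i
        · rw [if_pos h, if_pos (by omega)]
        · rw [if_neg h, if_neg (by omega)]
    · simp only [hx, if_false]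
      by_cases hxy : (x.1 : ℕ) = (y.1 : ℕ) + 1
      · by_cases hy : (y.1 : ℕ) = i
        · simp [hxy, hy]
        · simp [hxy, hy]
      · simp [hxy]
  have hVU : ∀ i x y, (V i * U i) x y = if (x.1 : ℕ) = 0 then
      (if i = 0 then (S * co (y.1 + 1)) x.2 y.2 else
        (if (y.1 : ℕ) < i then (co (y.1 + 1) * S) x.2 y.2 else co (y.1 + 1) x.2 y.2))
      else if (x.1 : ℕ) = (y.1 : ℕ) + 1 then
        (if (x.1 : ℕ) = i then S x.2 y.2 else if x.2 = y.2 then 1 else 0) else 0 := by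
    intro i x y
    simp only [Matrix.mul_apply, U, V, Matrix.of_apply, Fintype.sum_prod_type]
    rw [Finset.sum_eq_single x.1 (by intro b _ hb; simp [hb.symm]) (by simp)]
    by_cases hx : (x.1 : ℕ) = 0
    · simp only [hx, if_true]
      by_cases hi : i = 0
      · simp [hi]
      · simp [hi, Ne.symm hi]
    · simp only [hx, if_false, if_true]
      by_cases hxy : (x.1 : ℕ) = (y.1 : ℕ) + 1
      · by_cases hxi : (x.1 : ℕ) = i
        · simp [hxy, ← hxi]
        · simp only [hxy, true_and, if_true]
          simp [← hxy, hxi]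
      · simp [hxy]
  have hco : ∀ e i j, 0 ≤ co e i j := fun e i j => hT i j e
  have hcoS : ∀ e i j, 0 ≤ (co e * S) i j := fun e i j => by
    rw [Matrix.mul_apply]
    exact Finset.sum_nonneg fun l _ => mul_nonneg (hco _ _ _) (hS _ _)
  have hU : ∀ i x y, 0 ≤ U i x y := by
    intro i x y
    simp only [U, Matrix.of_apply]
    split_ifs
    · exact hcoS _ _ _
    · exact hco _ _ _
    · simp
    · simp
  have hV : ∀ i x y, 0 ≤ V i x y := by
    intro i x y
    simp only [V, Matrix.of_apply]
    split_ifs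
    · exact hS _ _
    all_goals simp
  have hstep : ∀ i, SSE {x : ℤ | 0 ≤ x} (V i * U i) (V (i + 1) * U (i + 1)) := by
    intro i
    refine SSE.mul_comm' (V i) (U i) (hV i) (hU i) rfl ?_
    ext x y
    rw [hUV, hVU]
    by_cases hx : (x.1 : ℕ) = 0
    · simp [hx]
    · by_cases hxy : (x.1 : ℕ) = (y.1 : ℕ) + 1
      · simp [hxy]
      · simp [hx, hxy]
  have hall : ∀ i, SSE {x : ℤ | 0 ≤ x} (V 0 * U 0) (V i * U i) := by
    intro i
    induction i with
    | zero =>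
      refine SSE.refl' _ fun x y => ?_
      rw [Matrix.mul_apply]
      exact Finset.sum_nonneg fun l _ => mul_nonneg (hV _ _ _) (hU _ _ _)
    | succ i ih => exact ih.trans (hstep i)
  have hcoef1 : ∀ e i j, ((S.map Polynomial.C * T) i j).coeff e = (S * co e) i j := by
    intro e i j
    simp [Matrix.mul_apply, co]
  have hcoef2 : ∀ e i j, ((T * S.map Polynomial.C) i j).coeff e = (co e * S) i j := by
    intro e i j
    simp [Matrix.mul_apply, co]
  convert hall (L + 1) using 1
  · ext x y
    rw [hVU]
    simp only [boxL, Matrix.of_apply, hcoef1, if_true]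
    by_cases hx : (x.1 : ℕ) = 0
    · simp [hx]
    · by_cases hxy : (x.1 : ℕ) = (y.1 : ℕ) + 1
      · simp [hxy]
      · simp [hx, hxy]
  · ext x y
    rw [hVU]
    have h1 := y.1.2
    have h2 : (x.1 : ℕ) ≠ L + 1 := by have := x.1.2; omega
    have h3 : (y.1 : ℕ) < L + 1 := by omega
    simp only [boxL, Matrix.of_apply, hcoef2, Nat.succ_ne_zero, h2, h3, if_true, if_false]
    by_cases hx : (x.1 : ℕ) = 0
    · simp [hx]
    · by_cases hxy : (x.1 : ℕ) = (y.1 : ℕ) + 1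
      · simp [hxy]
      · simp [hx, hxy]

end StrongShift

/-! ### Expansion of the row of `i₀` by first-passage paths. -/

section FirstPassage

variable {R : Type*} [Ring R] {n : Type*} [Fintype n] [DecidableEq n]

/-- `firstPass A i₀ e` counts the paths of length `e + 1` from `i₀` that do not return to `i₀`
before their end. -/
def firstPass (A : Matrix n n R) (i₀ : n) : ℕ → n → R
  | 0 => A i₀
  | e + 1 => fun j => ∑ l, if l = i₀ then 0 else firstPass A i₀ e l * A l j

/-- The matrix obtained from `tA` by deleting the paths of `expandRow A i₀ q` that leave `i₀` for
another vertex. -/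
def expandRowLoops (A : Matrix n n R) (i₀ : n) (q : ℕ) : Matrix n n R[X] :=
  Matrix.of fun i j =>
    if i = i₀ then (if j = i₀ then ∑ e ∈ Finset.range (q + 1), monomial (e + 1) (firstPass A i₀ e i₀)
      else 0)
    else monomial 1 (A i j)

/-- The edges from `i₀` to other vertices in `expandRow A i₀ q`. -/
def expandRowExit (A : Matrix n n R) (i₀ : n) (q : ℕ) : Matrix n n R :=
  Matrix.of fun i j => if i = i₀ ∧ j ≠ i₀ then firstPass A i₀ q j else 0

/-- The matrix obtained from `tA` by replacing the edges that leave `i₀` with the paths from `i₀`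
that have length `q + 1`, or stop at their first return to `i₀`. -/
def expandRow (A : Matrix n n R) (i₀ : n) (q : ℕ) : Matrix n n R[X] :=
  expandRowLoops A i₀ q + (expandRowExit A i₀ q).map (monomial (q + 1))

theorem expandRow_zero (A : Matrix n n R) (i₀ : n) : expandRow A i₀ 0 = tMul A := by
  ext1 i j
  simp only [expandRow, expandRowLoops, expandRowExit, tMul, Matrix.add_apply, Matrix.of_apply,
    Matrix.map_apply]
  by_cases hi : i = i₀
  · by_cases hj : j = i₀ <;> simp [hi, hj, firstPass]
  · simp [hi]

theorem expandRowExit_mul (A : Matrix n n R) (i₀ : n) (q : ℕ) (M : Matrix n n R[X])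
    (hM : ∀ i j, i ≠ i₀ → M i j = monomial 1 (A i j)) :
    (expandRowExit A i₀ q).map (monomial (q + 1)) * M =
      Matrix.of fun i j => if i = i₀ then monomial (q + 2) (firstPass A i₀ (q + 1) j) else 0 := by
  ext1 i j
  simp only [Matrix.mul_apply, Matrix.of_apply, expandRowExit, Matrix.map_apply]
  by_cases hi : i = i₀
  · simp only [hi, true_and, if_true, firstPass, map_sum]
    refine Finset.sum_congr rfl fun l _ => ?_
    by_cases hl : l = i₀
    · simp [hl]
    · rw [hM l j hl]
      simp [hl, monomial_mul_monomial]
  · simp [hi]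

/-- Exit edges end outside `i₀`, where every edge is an edge of `A` of length one. Appending such an
edge either closes a new first-return loop or gives an exit of length `q + 2`. -/
theorem expandRow_succ (A : Matrix n n R) (i₀ : n) (q : ℕ) :
    expandRow A i₀ (q + 1) = expandRowLoops A i₀ q +
      (expandRowExit A i₀ q).map (monomial (q + 1)) * expandRowLoops A i₀ q := by
  rw [expandRowExit_mul _ _ _ _ (fun i j hi => by simp [expandRowLoops, hi])]
  ext1 i j
  simp only [expandRow, expandRowLoops, expandRowExit, Matrix.add_apply, Matrix.of_apply,
    Matrix.map_apply]
  by_cases hi : i = i₀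
  · by_cases hj : j = i₀
    · simp only [hi, hj, if_true, Finset.sum_range_succ _ (q + 1)]
      simp
    · simp [hi, hj]
  · simp [hi]

/-- Each step multiplies by `1 + D` with `D` the exit part. As `D` leads from `i₀` to other
vertices, `D * D = 0` and `1 + D` is a product of elementary matrices. -/
theorem exists_El_expandRow (A : Matrix n n R) (i₀ : n) (q : ℕ) :
    ∃ E ∈ El n R[X], E * (1 - tMul A) = 1 - expandRow A i₀ q := by
  induction q with
  | zero => exact ⟨1, one_mem _, by rw [expandRow_zero, one_mul]⟩
  | succ q ih =>
    obtain ⟨E, hE, h⟩ := ih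
    set D := (expandRowExit A i₀ q).map (monomial (q + 1)) with hD
    have hDD : D * D = 0 := by
      ext1 i j
      simp only [hD, expandRowExit, Matrix.mul_apply, Matrix.map_apply, Matrix.of_apply,
        Matrix.zero_apply]
      refine Finset.sum_eq_zero fun l _ => ?_
      by_cases hl : l = i₀ <;> simp [hl]
    refine ⟨(1 + D) * E, mul_mem (one_add_mem_El (fun i => i = i₀) D fun i j hij => ?_) hE, ?_⟩
    · by_contra hc
      apply hij
      have : ¬(i = i₀ ∧ j ≠ i₀) := hc
      simp [hD, expandRowExit, this]
    · rw [mul_assoc, h, expandRow_succ, ← hD, expandRow, ← hD]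
      have : (1 + D) * (1 - (expandRowLoops A i₀ q + D)) =
          1 - (expandRowLoops A i₀ q + D * expandRowLoops A i₀ q) - D * D := by
        noncomm_ring
      rw [this, hDD, sub_zero]

theorem map_firstPass {R' : Type*} [Ring R'] (f : R →+* R') (A : Matrix n n R) (i₀ : n) (e : ℕ)
    (j : n) : f (firstPass A i₀ e j) = firstPass (A.map f) i₀ e j := by
  induction e generalizing j with
  | zero => rfl
  | succ e ih =>
    simp only [firstPass, map_sum]
    refine Finset.sum_congr rfl fun l _ => ?_
    split_ifs
    · simp
    · rw [map_mul, ih]; rfl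

theorem map_expandRow {R' : Type*} [Ring R'] (f : R →+* R') (A : Matrix n n R) (i₀ : n) (q : ℕ) :
    (expandRow A i₀ q).map (mapRingHom f) = expandRow (A.map f) i₀ q := by
  ext1 i j
  simp only [expandRow, expandRowLoops, expandRowExit, Matrix.add_apply, Matrix.of_apply,
    Matrix.map_apply, coe_mapRingHom, Polynomial.map_add, map_monomial, ← map_firstPass f]
  congr 1
  · by_cases hi : i = i₀
    · by_cases hj : j = i₀
      · simp [hi, hj, Polynomial.map_sum]
      · simp [hi, hj]
    · simp [hi]
  · by_cases h : i = i₀ ∧ j ≠ i₀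
    · simp [h]
    · simp only [h, if_false, map_zero]

end FirstPassage

/-! ### The row expansion as a strong shift equivalence. -/

section IntegerChain

theorem coeff_mul_nonneg {p q : ℤ[X]} (hp : ∀ e, 0 ≤ p.coeff e) (hq : ∀ e, 0 ≤ q.coeff e) (e : ℕ) :
    0 ≤ (p * q).coeff e := by
  rw [coeff_mul]
  exact Finset.sum_nonneg fun x _ => mul_nonneg (hp _) (hq _)

theorem coeff_matrix_mul_nonneg {l m n : Type*} [Fintype m] {M : Matrix l m ℤ[X]}
    {N : Matrix m n ℤ[X]} (hM : ∀ i j e, 0 ≤ (M i j).coeff e) (hN : ∀ i j e, 0 ≤ (N i j).coeff e)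
    (i j) (e : ℕ) : 0 ≤ ((M * N) i j).coeff e := by
  rw [Matrix.mul_apply, finsetSum_coeff]
  exact Finset.sum_nonneg fun x _ => coeff_mul_nonneg (hM _ _) (hN _ _) e

theorem firstPass_nonneg {n : Type*} [Fintype n] [DecidableEq n] (A : Matrix n n ℤ)
    (hA : ∀ i j, 0 ≤ A i j) (i₀ : n) (e : ℕ) (j : n) : 0 ≤ firstPass A i₀ e j := by
  induction e generalizing j with
  | zero => exact hA _ _
  | succ e ih =>
    refine Finset.sum_nonneg fun l _ => ?_
    split_ifs
    · exact le_rfl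
    · exact mul_nonneg (ih l) (hA _ _)

variable {k n : Type} [Fintype k] [DecidableEq k] [Fintype n] [DecidableEq n]

/-- The zero block reserves the vertices that `sse_pathBlocks` brings to life. The bound on `L`
leaves room for an exit edge followed by a loop. -/
theorem sse_expandRow (A : Matrix n n ℤ) (hA : ∀ i j, 0 ≤ A i j) (i₀ : n) (q L : ℕ)
    (hL : 2 * q + 1 ≤ L) :
    SSE {x : ℤ | 0 ≤ x} A
      (boxL L (Matrix.fromBlocks (0 : Matrix k k ℤ[X]) 0 0 (expandRow A i₀ q))) := by
  induction q with
  | zero =>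
    rw [expandRow_zero]
    have hnn : ∀ i j e, 0 ≤ (Matrix.fromBlocks (0 : Matrix k k ℤ[X]) 0 0 (tMul A) i j).coeff e := by
      rintro (i | i) (j | j) e <;> simp only [Matrix.fromBlocks_apply₁₁, Matrix.fromBlocks_apply₁₂,
        Matrix.fromBlocks_apply₂₁, Matrix.fromBlocks_apply₂₂, Matrix.zero_apply, coeff_zero, le_rfl,
        tMul, Matrix.map_apply, coeff_monomial]
      split_ifs
      · exact hA _ _
      · exact le_rfl
    refine SSE.symm' ((sse_boxL_le 1 L (by omega) _ hnn ?_).trans ?_)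
    · rintro (i | i) (j | j) e he <;> simp only [Matrix.fromBlocks_apply₁₁,
        Matrix.fromBlocks_apply₁₂, Matrix.fromBlocks_apply₂₁, Matrix.fromBlocks_apply₂₂,
        Matrix.zero_apply, coeff_zero, tMul, Matrix.map_apply, coeff_monomial]
      rw [if_neg (by omega)]
    · have := SSE.submatrix (boxL 1 (Matrix.fromBlocks (0 : Matrix k k ℤ[X]) 0 0 (tMul A)))
        (boxL_nonneg _ _ hnn) (fun j : n => ((0 : Fin 1), Sum.inr j))
        (fun a b hab => by simpa using hab) ?_
      · have h2 : (boxL 1 (Matrix.fromBlocks (0 : Matrix k k ℤ[X]) 0 0 (tMul A))).submatrix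
            (fun j : n => ((0 : Fin 1), Sum.inr j)) (fun j : n => ((0 : Fin 1), Sum.inr j)) = A := by
          ext i j
          simp [boxL, tMul]
        rwa [h2] at this
      · rintro ⟨a, i⟩ ⟨b, j | j⟩ hb
        · have ha : (a : ℕ) = 0 := by omega
          simp only [boxL, Matrix.of_apply, ha, if_true]
          rcases i with i | i <;> simp
        · exact absurd ⟨j, by simp [Subsingleton.elim b 0]⟩ hb
  | succ q ih =>
    refine (ih (by omega)).trans ?_
    have hfp := firstPass_nonneg A hA i₀
    have key := sse_boxL_expand L (q + 1) (by omega) (by omega)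
      (Matrix.fromBlocks (0 : Matrix k k ℤ[X]) 0 0 (expandRowLoops A i₀ q))
      (Matrix.fromBlocks (0 : Matrix k k ℤ) 0 0 (expandRowExit A i₀ q)) (fun x => x ≠ Sum.inr i₀)
      ?_ ?_ ?_ ?_ ?_
    · have e1 : (Matrix.fromBlocks (0 : Matrix k k ℤ) 0 0 (expandRowExit A i₀ q)).map
          (monomial (q + 1)) = Matrix.fromBlocks (0 : Matrix k k ℤ[X]) 0 0
            ((expandRowExit A i₀ q).map (monomial (q + 1))) := by
        rw [Matrix.fromBlocks_map]
        simp
      rw [e1, Matrix.fromBlocks_multiply, Matrix.fromBlocks_add, Matrix.fromBlocks_add] at key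
      rw [expandRow_succ]
      simpa [expandRow] using key
    · rintro (i | i) (j | j) e <;> simp only [Matrix.fromBlocks_apply₁₁, Matrix.fromBlocks_apply₁₂,
        Matrix.fromBlocks_apply₂₁, Matrix.fromBlocks_apply₂₂, Matrix.zero_apply, coeff_zero, le_rfl,
        expandRowLoops, Matrix.of_apply]
      split_ifs
      · rw [finsetSum_coeff]
        refine Finset.sum_nonneg fun x _ => ?_
        rw [coeff_monomial]
        split_ifs
        · exact hfp _ _
        · exact le_rfl
      · simp
      · rw [coeff_monomial]
        split_ifs
        · exact hA _ _
        · exact le_rfl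
    · rintro (i | i) (j | j) <;> simp only [Matrix.fromBlocks_apply₁₁, Matrix.fromBlocks_apply₁₂,
        Matrix.fromBlocks_apply₂₁, Matrix.fromBlocks_apply₂₂, Matrix.zero_apply, coeff_zero,
        expandRowLoops, Matrix.of_apply]
      split_ifs
      · rw [finsetSum_coeff]
        refine Finset.sum_eq_zero fun x _ => ?_
        rw [coeff_monomial, if_neg (by omega)]
      · simp
      · rw [coeff_monomial, if_neg (by omega)]
    · rintro (i | i) (j | j) <;> simp only [Matrix.fromBlocks_apply₁₁, Matrix.fromBlocks_apply₁₂,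
        Matrix.fromBlocks_apply₂₁, Matrix.fromBlocks_apply₂₂, Matrix.zero_apply, le_rfl,
        expandRowExit, Matrix.of_apply]
      split_ifs
      · exact hfp _ _
      · exact le_rfl
    · rintro (i | i) (j | j) <;> simp [expandRowExit]
      tauto
    · rintro (i | i) (j | j) e he <;> simp only [Matrix.fromBlocks_apply₁₁,
        Matrix.fromBlocks_apply₁₂, Matrix.fromBlocks_apply₂₁, Matrix.fromBlocks_apply₂₂,
        Matrix.zero_apply, coeff_zero, expandRowLoops, Matrix.of_apply]
      split_ifs
      · rw [finsetSum_coeff]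
        refine Finset.sum_eq_zero fun x hx => ?_
        rw [Finset.mem_range] at hx
        rw [coeff_monomial, if_neg (by omega)]
      · simp
      · rw [coeff_monomial, if_neg (by omega)]

end IntegerChain

/-! ### The block transformation as a strong shift equivalence. -/

section IntegerBlocks

theorem exists_coeff_bound {l m : Type*} [Fintype l] [Fintype m] {R : Type*} [Ring R]
    (M : Matrix l m R[X]) : ∃ d, ∀ i j e, d < e → (M i j).coeff e = 0 := by
  refine ⟨Finset.univ.sup fun i => Finset.univ.sup fun j => (M i j).natDegree, fun i j e he => ?_⟩
  refine coeff_eq_zero_of_natDegree_lt (lt_of_le_of_lt ?_ he)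
  exact (Finset.le_sup (f := fun j => (M i j).natDegree) (Finset.mem_univ j)).trans
    (Finset.le_sup (f := fun i => Finset.univ.sup fun j => (M i j).natDegree) (Finset.mem_univ i))

theorem coeff_matrix_mul_eq_zero {l m n : Type*} [Fintype m] {R : Type*} [Ring R]
    {M : Matrix l m R[X]} {N : Matrix m n R[X]} {a b : ℕ}
    (hM : ∀ i j e, a < e → (M i j).coeff e = 0) (hN : ∀ i j e, b < e → (N i j).coeff e = 0)
    (i j) (e : ℕ) (he : a + b < e) : ((M * N) i j).coeff e = 0 := by
  rw [Matrix.mul_apply, finsetSum_coeff]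
  refine Finset.sum_eq_zero fun x _ => ?_
  rw [coeff_mul]
  refine Finset.sum_eq_zero fun y hy => ?_
  rw [Finset.HasAntidiagonal.mem_antidiagonal] at hy
  rcases lt_or_ge a y.1 with h | h
  · rw [hM _ _ _ h, zero_mul]
  · rw [hN _ _ _ (by omega), mul_zero]

/-- The part of degree less than `s` of a polynomial matrix. -/
def truncDeg {l m : Type*} {R : Type*} [Ring R] (s : ℕ) (M : Matrix l m R[X]) : Matrix l m R[X] :=
  M.map fun p => ∑ i ∈ Finset.range s, monomial i (p.coeff i)

theorem coeff_truncDeg {l m : Type*} {R : Type*} [Ring R] (s : ℕ) (M : Matrix l m R[X]) (i j)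
    (e : ℕ) : (truncDeg s M i j).coeff e = if e < s then (M i j).coeff e else 0 := by
  simp only [truncDeg, Matrix.map_apply, finsetSum_coeff, coeff_monomial]
  simp

theorem truncDeg_succ {l m : Type*} {R : Type*} [Ring R] (s : ℕ) (M : Matrix l m R[X]) :
    truncDeg (s + 1) M = truncDeg s M + (M.map fun p => p.coeff s).map (monomial s) := by
  ext1 i j
  simp [truncDeg, Finset.sum_range_succ]

theorem coeff_truncDeg_mul {l m n : Type*} [Fintype m] {R : Type*} [Ring R] (s : ℕ)
    (M : Matrix l m R[X]) (N : Matrix m n R[X]) (hN : ∀ i j, (N i j).coeff 0 = 0) (i j) (e : ℕ)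
    (he : e ≤ s) : ((truncDeg s M * N) i j).coeff e = ((M * N) i j).coeff e := by
  simp only [Matrix.mul_apply, finsetSum_coeff, coeff_mul]
  refine Finset.sum_congr rfl fun x _ => Finset.sum_congr rfl fun y hy => ?_
  rw [Finset.HasAntidiagonal.mem_antidiagonal] at hy
  rw [coeff_truncDeg]
  split_ifs with h
  · rfl
  · have : y.2 = 0 := by omega
    rw [this, hN, mul_zero, mul_zero]

variable {k n : Type} [Fintype k] [DecidableEq k] [Fintype n] [DecidableEq n]

/-- The matrix of a path expansion along `ρ`, starting from the edges `Y`. -/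
def pathBlocks {R : Type*} [Ring R] (Y ρ : Matrix k n R[X]) (S : Matrix n k R[X])
    (C : Matrix n n R[X]) : Matrix (k ⊕ n) (k ⊕ n) R[X] :=
  Matrix.fromBlocks ((Y + ρ * C) * S) (Y - ρ * (1 - C)) (C * S) C

/-- The case `ρ = 0` comes from the expanded row by commuting a constant factor. Afterwards `ρ` is
restored degree by degree: its degree `s` part is a family of edges from the new vertices to the old
ones, and each of these is replaced by its continuations along the kept part `K s`. -/
theorem sse_pathBlocks (A : Matrix n n ℤ) (hA : ∀ i j, 0 ≤ A i j) (i₀ : n) (q L : ℕ)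
    (Y ρ : Matrix k n ℤ[X]) (S : Matrix n k ℤ) (C : Matrix n n ℤ[X])
    (hY : ∀ i j e, 0 ≤ (Y i j).coeff e) (hY0 : ∀ i j, (Y i j).coeff 0 = 0)
    (hρ : ∀ i j e, 0 ≤ (ρ i j).coeff e) (hρ0 : ∀ i j, (ρ i j).coeff 0 = 0)
    (hC : ∀ i j e, 0 ≤ (C i j).coeff e) (hC0 : ∀ i j, (C i j).coeff 0 = 0)
    (hS : ∀ i j, 0 ≤ S i j) (hτ : ∀ i j e, 0 ≤ ((Y - ρ * (1 - C) : Matrix k n ℤ[X]) i j).coeff e)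
    (hAC : expandRow A i₀ q = S.map Polynomial.C * Y + C)
    (hL : ∀ i j e, L < e → (pathBlocks Y ρ (S.map Polynomial.C) C i j).coeff e = 0) :
    SSE {x : ℤ | 0 ≤ x} A (boxL L (pathBlocks Y ρ (S.map Polynomial.C) C)) := by
  set S' : Matrix n k ℤ[X] := S.map Polynomial.C with hS'
  have hS'nn : ∀ i j e, 0 ≤ (S' i j).coeff e := by
    intro i j e
    simp only [hS', Matrix.map_apply, coeff_C]
    split_ifs
    · exact hS _ _
    · exact le_rfl
  have hS'd : ∀ i j e, 0 < e → (S' i j).coeff e = 0 := by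
    intro i j e he
    simp only [hS', Matrix.map_apply, coeff_C, if_neg he.ne']
  obtain ⟨dY, hdY⟩ := exists_coeff_bound Y
  obtain ⟨dρ, hdρ⟩ := exists_coeff_bound ρ
  obtain ⟨dC, hdC⟩ := exists_coeff_bound C
  have htr : ∀ s i j e, 0 ≤ (truncDeg s ρ i j).coeff e := by
    intro s i j e
    rw [coeff_truncDeg]
    split_ifs
    · exact hρ _ _ _
    · exact le_rfl
  have htrd : ∀ s i j e, dρ < e → (truncDeg s ρ i j).coeff e = 0 := by
    intro s i j e he
    rw [coeff_truncDeg]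
    split_ifs
    · exact hdρ _ _ _ he
    · rfl
  have htrC : ∀ s, Y - truncDeg s ρ * (1 - C) = Y + truncDeg s ρ * C - truncDeg s ρ := by
    intro s
    rw [Matrix.mul_sub, Matrix.mul_one]
    abel
  have hnnYC : ∀ s i j e, 0 ≤ ((Y + truncDeg s ρ * C) i j).coeff e := by
    intro s i j e
    rw [Matrix.add_apply, coeff_add]
    exact add_nonneg (hY _ _ _) (coeff_matrix_mul_nonneg (htr s) hC _ _ _)
  have hdYC : ∀ s i j e, dY + dρ + dC < e → ((Y + truncDeg s ρ * C) i j).coeff e = 0 := by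
    intro s i j e he
    rw [Matrix.add_apply, coeff_add, hdY _ _ _ (by omega),
      coeff_matrix_mul_eq_zero (htrd s) hdC _ _ _ (by omega), add_zero]
  -- the part of the matrix that is kept in step `s`
  let K : ℕ → Matrix (k ⊕ n) (k ⊕ n) ℤ[X] := fun s =>
    Matrix.fromBlocks ((Y + truncDeg s ρ * C) * S') (Y + truncDeg s ρ * C - truncDeg (s + 1) ρ)
      (C * S') C
  let D : ℕ → Matrix (k ⊕ n) (k ⊕ n) ℤ := fun s =>
    Matrix.fromBlocks 0 (ρ.map fun p => p.coeff s) 0 0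
  have hDmap : ∀ s, (D s).map (monomial s) =
      Matrix.fromBlocks 0 ((ρ.map fun p => p.coeff s).map (monomial s)) 0 0 := by
    intro s
    simp only [D, Matrix.fromBlocks_map]
    simp
  have e1 : ∀ s, pathBlocks Y (truncDeg s ρ) S' C = K s + (D s).map (monomial s) := by
    intro s
    rw [hDmap, pathBlocks, Matrix.fromBlocks_add, Matrix.fromBlocks_inj, htrC, truncDeg_succ]
    refine ⟨(add_zero _).symm, ?_, (add_zero _).symm, (add_zero _).symm⟩
    abel
  have e2 : ∀ s, pathBlocks Y (truncDeg (s + 1) ρ) S' C =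
      K s + (D s).map (monomial s) * K s := by
    intro s
    rw [hDmap, pathBlocks, Matrix.fromBlocks_multiply, Matrix.fromBlocks_add,
      Matrix.fromBlocks_inj, htrC, truncDeg_succ]
    simp only [Matrix.zero_mul, zero_add, add_zero, Matrix.add_mul, ← Matrix.mul_assoc]
    refine ⟨?_, ?_, trivial, trivial⟩ <;> abel
  -- In degrees up to `s` the truncation of `ρ` does not affect `ρ * C`, so `hτ` applies. In higher
  -- degrees nothing is subtracted.
  have hKtr : ∀ s i j e, 0 ≤ ((Y + truncDeg s ρ * C - truncDeg (s + 1) ρ) i j).coeff e := by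
    intro s i j e
    rw [Matrix.sub_apply, coeff_sub, coeff_truncDeg]
    split_ifs with h
    · have := hτ i j e
      rw [Matrix.mul_sub, Matrix.mul_one, Matrix.sub_apply, Matrix.sub_apply, coeff_sub,
        coeff_sub] at this
      rw [Matrix.add_apply, coeff_add, coeff_truncDeg_mul s ρ C hC0 i j e (by omega)]
      linarith
    · rw [sub_zero]
      exact hnnYC _ _ _ _
  have hKnn : ∀ s i j e, 0 ≤ (K s i j).coeff e := by
    rintro s (i | i) (j | j) e
    · exact coeff_matrix_mul_nonneg (hnnYC s) hS'nn _ _ _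
    · exact hKtr _ _ _ _
    · exact coeff_matrix_mul_nonneg hC hS'nn _ _ _
    · exact hC _ _ _
  have hc0 : ∀ {l : Type} (M : Matrix l n ℤ[X]) i j, ((M * C) i j).coeff 0 = 0 := by
    intro l M i j
    rw [Matrix.mul_apply, finsetSum_coeff]
    refine Finset.sum_eq_zero fun x _ => ?_
    rw [mul_coeff_zero, hC0, mul_zero]
  have hcS0 : ∀ {l : Type} (M : Matrix l n ℤ[X]), (∀ i j, (M i j).coeff 0 = 0) →
      ∀ i j, ((M * S') i j).coeff 0 = 0 := by
    intro l M hM i j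
    rw [Matrix.mul_apply, finsetSum_coeff]
    refine Finset.sum_eq_zero fun x _ => ?_
    rw [mul_coeff_zero, hM, zero_mul]
  have hYC0 : ∀ s i j, ((Y + truncDeg s ρ * C) i j).coeff 0 = 0 := by
    intro s i j
    rw [Matrix.add_apply, coeff_add, hY0, hc0, add_zero]
  have hK0 : ∀ s i j, (K s i j).coeff 0 = 0 := by
    rintro s (i | i) (j | j)
    · exact hcS0 _ (hYC0 s) _ _
    · show ((Y + truncDeg s ρ * C - truncDeg (s + 1) ρ) i j).coeff 0 = 0
      rw [Matrix.sub_apply, coeff_sub, hYC0, coeff_truncDeg, hρ0]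
      simp
    · exact hcS0 _ hC0 _ _
    · exact hC0 _ _
  have hKd : ∀ s i j e, dY + dρ + dC < e → (K s i j).coeff e = 0 := by
    rintro s (i | i) (j | j) e he
    · exact coeff_matrix_mul_eq_zero (hdYC s) hS'd _ _ _ (by omega)
    · show ((Y + truncDeg s ρ * C - truncDeg (s + 1) ρ) i j).coeff e = 0
      rw [Matrix.sub_apply, coeff_sub, hdYC s _ _ _ he, htrd _ _ _ _ (by omega), sub_zero]
    · exact coeff_matrix_mul_eq_zero hdC hS'd _ _ _ (by omega)
    · exact hdC _ _ _ (by omega)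
  set N := dρ + 1 with hN
  -- Enough blocks for the row expansion and for every expansion step; the surplus is removed at the
  -- end by `sse_boxL_le`.
  set L' := 2 * q + 1 + L + N + dY + dρ + dC with hL'
  have hstart : SSE {x : ℤ | 0 ≤ x} A (boxL L' (pathBlocks Y (truncDeg 1 ρ) S' C)) := by
    have h1 := sse_expandRow (k := k) A hA i₀ q L' (by omega)
    -- One order of the product gives `0 ⊕ (S Y + C)`, the other gives `pathBlocks` with `ρ = 0`.
    have h2 := sse_boxL_mul_comm L' (Matrix.fromBlocks (0 : Matrix k k ℤ[X]) Y 0 C)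
      (Matrix.fromBlocks (0 : Matrix k k ℤ) 0 S (1 : Matrix n n ℤ)) ?_ ?_
    · have e3 : (Matrix.fromBlocks (0 : Matrix k k ℤ) 0 S (1 : Matrix n n ℤ)).map Polynomial.C =
          Matrix.fromBlocks (0 : Matrix k k ℤ[X]) 0 S' (1 : Matrix n n ℤ[X]) := by
        rw [Matrix.fromBlocks_map, hS']
        congr 1
        · ext1; simp
        · ext1; simp
        · ext1 i j
          by_cases h : i = j <;> simp [Matrix.one_apply, h]
      have e4 : truncDeg 1 ρ = 0 := by
        ext1 i j
        simp [truncDeg, hρ0]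
      rw [e3, Matrix.fromBlocks_multiply, Matrix.fromBlocks_multiply] at h2
      simp only [Matrix.zero_mul, Matrix.mul_zero, Matrix.one_mul, Matrix.mul_one, add_zero,
        zero_add] at h2
      rw [hAC] at h1
      rw [pathBlocks, e4]
      simp only [Matrix.zero_mul, add_zero, sub_zero]
      exact h1.trans h2
    · rintro (i | i) (j | j) e
      · simp
      · exact hY _ _ _
      · simp
      · exact hC _ _ _
    · rintro (i | i) (j | j)
      · simp
      · simp
      · exact hS _ _
      · simp only [Matrix.fromBlocks_apply₂₂, Matrix.one_apply]
        split_ifs <;> simp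
  have hsteps : ∀ s, s ≤ N → SSE {x : ℤ | 0 ≤ x} A
      (boxL L' (pathBlocks Y (truncDeg (s + 1) ρ) S' C)) := by
    intro s
    induction s with
    | zero => exact fun _ => hstart
    | succ s ih =>
      intro hs
      refine (ih (by omega)).trans ?_
      rw [e1, e2]
      refine sse_boxL_expand L' (s + 1) (by omega) (by omega) (K (s + 1)) (D (s + 1))
        (fun x => x.isRight = true) (hKnn _) (hK0 _) ?_ ?_ fun i j e he => hKd _ _ _ _ (by omega)
      · rintro (i | i) (j | j)
        · simp [D]
        · exact hρ _ _ _
        · simp [D]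
        · simp [D]
      · rintro (i | i) (j | j) <;> simp [D]
  have hfin := hsteps N le_rfl
  have e5 : truncDeg (N + 1) ρ = ρ := by
    ext i j e
    rw [coeff_truncDeg]
    split_ifs with h
    · rfl
    · exact (hdρ _ _ _ (by omega)).symm
  rw [e5] at hfin
  refine hfin.trans (sse_boxL_le L L' (by omega) _ ?_ hL)
  rintro (i | i) (j | j) e
  · have h1 := hnnYC (N + 1)
    rw [e5] at h1
    exact coeff_matrix_mul_nonneg h1 hS'nn _ _ _
  · exact hτ _ _ _
  · exact coeff_matrix_mul_nonneg hC hS'nn _ _ _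
  · exact hC _ _ _

end IntegerBlocks

/-! ### Positivity in the group ring and criteria for primitivity. -/

section Positivity

variable {G : Type*} [Group G]

theorem Nonneg.zero : Nonneg (0 : ZG G) := fun g => by simp

theorem Nonneg.single (g : G) {c : ℤ} (hc : 0 ≤ c) : Nonneg (MonoidAlgebra.single g c : ZG G) := by
  classical
  intro h
  rw [MonoidAlgebra.coeff_single, Finsupp.single_apply]
  split_ifs
  · exact hc
  · exact le_rfl

theorem Nonneg.one : Nonneg (1 : ZG G) := by
  rw [MonoidAlgebra.one_def]
  exact Nonneg.single 1 zero_le_one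

theorem Nonneg.add {x y : ZG G} (hx : Nonneg x) (hy : Nonneg y) : Nonneg (x + y) := fun g => by
  rw [MonoidAlgebra.coeff_add]
  exact add_nonneg (hx g) (hy g)

theorem coeff_sum_apply {ι : Type*} (s : Finset ι) (f : ι → ZG G) (g : G) :
    (∑ i ∈ s, f i).coeff g = ∑ i ∈ s, (f i).coeff g := by
  rw [MonoidAlgebra.coeff_sum, Finsupp.finsetSum_apply]

theorem Nonneg.sum {ι : Type*} {s : Finset ι} {f : ι → ZG G} (h : ∀ i ∈ s, Nonneg (f i)) :
    Nonneg (∑ i ∈ s, f i) := fun g => by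
  rw [coeff_sum_apply]
  exact Finset.sum_nonneg fun i hi => h i hi g

theorem StrictlyPos.nonneg {x : ZG G} (hx : StrictlyPos x) : Nonneg x := fun g => (hx g).le

theorem StrictlyPos.ne_zero {x : ZG G} (hx : StrictlyPos x) : x ≠ 0 := by
  rintro rfl
  simpa using hx 1

theorem Nonneg.exists_pos {x : ZG G} (hx : Nonneg x) (h : x ≠ 0) : ∃ g, 0 < x.coeff g := by
  by_contra hc
  push Not at hc
  apply h
  rw [← MonoidAlgebra.coeff_eq_zero]
  ext g
  exact le_antisymm (hc g) (hx g)

theorem coeff_single_mul' (g h : G) (x : ZG G) :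
    (MonoidAlgebra.single g (1 : ℤ) * x : ZG G).coeff h = x.coeff (g⁻¹ * h) := by
  rw [MonoidAlgebra.coeff_single_mul_apply, one_mul]

variable [Fintype G]

theorem coeff_mul_eq_sum (x y : ZG G) (g : G) :
    (x * y).coeff g = ∑ h, x.coeff h * y.coeff (h⁻¹ * g) := by
  rw [MonoidAlgebra.coeff_mul_apply_left, Finsupp.sum_fintype]
  intro i
  simp

theorem coeff_mul_eq_sum' (x y : ZG G) (g : G) :
    (x * y).coeff g = ∑ h, x.coeff (g * h⁻¹) * y.coeff h := by
  rw [coeff_mul_eq_sum]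
  refine Fintype.sum_equiv ((Equiv.inv G).trans (Equiv.mulRight g)) _ _ fun h => ?_
  simp

theorem aug_eq_sum (x : ZG G) : aug x = ∑ g, x.coeff g := by
  rw [aug_apply, Finsupp.sum_fintype]
  intro i
  rfl

theorem Nonneg.mul {x y : ZG G} (hx : Nonneg x) (hy : Nonneg y) : Nonneg (x * y) := fun g => by
  rw [coeff_mul_eq_sum]
  exact Finset.sum_nonneg fun h _ => mul_nonneg (hx _) (hy _)

theorem Nonneg.aug_nonneg {x : ZG G} (hx : Nonneg x) : 0 ≤ aug x := by
  rw [aug_eq_sum]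
  exact Finset.sum_nonneg fun g _ => hx g

theorem Nonneg.coeff_le_aug {x : ZG G} (hx : Nonneg x) (g : G) : x.coeff g ≤ aug x := by
  rw [aug_eq_sum]
  exact Finset.single_le_sum (f := fun g => x.coeff g) (fun h _ => hx h) (Finset.mem_univ g)

/-- A lower bound for the coefficients of a product. -/
theorem le_coeff_mul {x y : ZG G} {c : ℝ} (hx : ∀ g, c ≤ (x.coeff g : ℝ)) (hy : Nonneg y) (g : G) :
    c * (aug y : ℝ) ≤ ((x * y).coeff g : ℝ) := by
  rw [coeff_mul_eq_sum', aug_eq_sum]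
  push_cast
  rw [Finset.mul_sum]
  exact Finset.sum_le_sum fun h _ => mul_le_mul_of_nonneg_right (hx _) (by exact_mod_cast hy h)

theorem Nonneg.aug_pos {x : ZG G} (hx : Nonneg x) (h : x ≠ 0) : 0 < aug x := by
  obtain ⟨g, hg⟩ := hx.exists_pos h
  exact hg.trans_le (hx.coeff_le_aug g)

theorem Nonneg.mul_ne_zero {x y : ZG G} (hx : Nonneg x) (hy : Nonneg y) (hx0 : x ≠ 0)
    (hy0 : y ≠ 0) : x * y ≠ 0 := by
  intro h
  have : aug (x * y) = 0 := by rw [h, map_zero]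
  rw [map_mul] at this
  exact (mul_pos (hx.aug_pos hx0) (hy.aug_pos hy0)).ne' this

theorem StrictlyPos.mul_nonneg {x y : ZG G} (hx : StrictlyPos x) (hy : Nonneg y) (hy0 : y ≠ 0) :
    StrictlyPos (x * y) := by
  intro g
  rw [coeff_mul_eq_sum']
  obtain ⟨h, hh⟩ := hy.exists_pos hy0
  exact Finset.sum_pos' (fun l _ => Int.mul_nonneg (hx _).le (hy _))
    ⟨h, Finset.mem_univ _, Int.mul_pos (hx _) hh⟩

theorem StrictlyPos.nonneg_mul {x y : ZG G} (hx : Nonneg x) (hx0 : x ≠ 0) (hy : StrictlyPos y) :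
    StrictlyPos (x * y) := by
  intro g
  rw [coeff_mul_eq_sum]
  obtain ⟨h, hh⟩ := hx.exists_pos hx0
  exact Finset.sum_pos' (fun l _ => Int.mul_nonneg (hx _) (hy _).le)
    ⟨h, Finset.mem_univ _, Int.mul_pos hh (hy _)⟩

theorem StrictlyPos.sum {ι : Type*} {s : Finset ι} {f : ι → ZG G} (h : ∀ i ∈ s, Nonneg (f i))
    {i : ι} (hi : i ∈ s) (hp : StrictlyPos (f i)) : StrictlyPos (∑ i ∈ s, f i) := fun g => by
  rw [coeff_sum_apply]
  exact Finset.sum_pos' (fun j hj => h j hj g) ⟨i, hi, hp g⟩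

theorem Nonneg.sum_ne_zero {ι : Type*} {s : Finset ι} {f : ι → ZG G} (h : ∀ i ∈ s, Nonneg (f i))
    {i : ι} (hi : i ∈ s) (hp : f i ≠ 0) : ∑ i ∈ s, f i ≠ 0 := by
  obtain ⟨g, hg⟩ := (h i hi).exists_pos hp
  intro h0
  have h1 : 0 < (∑ i ∈ s, f i).coeff g := by
    rw [coeff_sum_apply]
    exact Finset.sum_pos' (fun j hj => h j hj g) ⟨i, hi, hg⟩
  rw [h0] at h1
  simp at h1

section Matrix

variable {m : Type*} [Fintype m] [DecidableEq m] {K : Matrix m m (ZG G)}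

theorem nonneg_matrix_mul {l n : Type*} {M : Matrix l m (ZG G)} {N : Matrix m n (ZG G)}
    (hM : ∀ i j, Nonneg (M i j)) (hN : ∀ i j, Nonneg (N i j)) (i j) : Nonneg ((M * N) i j) := by
  rw [Matrix.mul_apply]
  exact Nonneg.sum fun x _ => (hM _ _).mul (hN _ _)

theorem nonneg_matrix_pow (hK : ∀ i j, Nonneg (K i j)) (p : ℕ) (i j) : Nonneg ((K ^ p) i j) := by
  induction p generalizing i j with
  | zero =>
    rw [pow_zero, Matrix.one_apply]
    split_ifs
    · exact Nonneg.one
    · exact Nonneg.zero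
  | succ p ih =>
    rw [pow_succ]
    exact nonneg_matrix_mul ih hK i j

theorem pow_add_ne_zero (hK : ∀ i j, Nonneg (K i j)) {p q : ℕ} {i j l : m} (h1 : (K ^ p) i j ≠ 0)
    (h2 : (K ^ q) j l ≠ 0) : (K ^ (p + q)) i l ≠ 0 := by
  rw [pow_add, Matrix.mul_apply]
  have hp := nonneg_matrix_pow hK p
  have hq := nonneg_matrix_pow hK q
  exact Nonneg.sum_ne_zero (fun x _ => (hp _ _).mul (hq _ _)) (Finset.mem_univ j)
    ((hp _ _).mul_ne_zero (hq _ _) h1 h2)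

theorem strictlyPos_pow_add_left (hK : ∀ i j, Nonneg (K i j)) {p q : ℕ} {i j l : m}
    (h1 : StrictlyPos ((K ^ p) i j)) (h2 : (K ^ q) j l ≠ 0) : StrictlyPos ((K ^ (p + q)) i l) := by
  rw [pow_add, Matrix.mul_apply]
  have hp := nonneg_matrix_pow hK p
  have hq := nonneg_matrix_pow hK q
  exact StrictlyPos.sum (fun x _ => (hp _ _).mul (hq _ _)) (Finset.mem_univ j)
    (h1.mul_nonneg (hq _ _) h2)

theorem strictlyPos_pow_add_right (hK : ∀ i j, Nonneg (K i j)) {p q : ℕ} {i j l : m}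
    (h1 : (K ^ p) i j ≠ 0) (h2 : StrictlyPos ((K ^ q) j l)) : StrictlyPos ((K ^ (p + q)) i l) := by
  rw [pow_add, Matrix.mul_apply]
  have hp := nonneg_matrix_pow hK p
  have hq := nonneg_matrix_pow hK q
  exact StrictlyPos.sum (fun x _ => (hp _ _).mul (hq _ _)) (Finset.mem_univ j)
    (StrictlyPos.nonneg_mul (hp _ _) h1 h2)

theorem exists_pow_ne_zero (hK : ∀ i j, Nonneg (K i j)) {i j : m}
    (h : Relation.ReflTransGen (fun i j => K i j ≠ 0) i j) : ∃ p, (K ^ p) i j ≠ 0 := by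
  induction h with
  | refl => exact ⟨0, by simp⟩
  | tail _ h ih =>
    obtain ⟨p, hp⟩ := ih
    exact ⟨p + 1, pow_add_ne_zero hK hp (by simpa using h)⟩

/-- Every large integer is a sum of copies of `s` and `s + 1`, so all long closed paths at `x` have
strictly positive weight. Strict positivity survives multiplication by nonzero nonnegative elements,
hence also the detour from any `y` through `x` to any `z`. -/
theorem GPrimitive.of_loops (hK : ∀ i j, Nonneg (K i j)) (x : m) (s : ℕ)
    (h1 : StrictlyPos ((K ^ s) x x)) (h2 : StrictlyPos ((K ^ (s + 1)) x x))
    (hto : ∀ y, Relation.ReflTransGen (fun i j => K i j ≠ 0) y x)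
    (hfrom : ∀ y, Relation.ReflTransGen (fun i j => K i j ≠ 0) x y) : GPrimitive K := by
  refine ⟨hK, ?_⟩
  choose a ha using fun y => exists_pow_ne_zero hK (hto y)
  choose b hb using fun y => exists_pow_ne_zero hK (hfrom y)
  have hmul : ∀ t, StrictlyPos ((K ^ t) x x) → ∀ q, StrictlyPos ((K ^ (t * (q + 1))) x x) := by
    intro t ht q
    induction q with
    | zero => simpa using ht
    | succ q ih =>
      rw [mul_add_one]
      exact strictlyPos_pow_add_left hK ih ht.ne_zero
  have hlarge : ∀ t, (s + 1) * (s + 1) ≤ t → StrictlyPos ((K ^ t) x x) := by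
    intro t ht
    rcases Nat.eq_zero_or_pos s with hs | hs
    · subst hs
      have := hmul _ h2 (t - 1)
      rwa [zero_add, one_mul, Nat.sub_add_cancel (by omega)] at this
    · have h3 := Nat.div_add_mod t s
      have h4 := Nat.mod_lt t hs
      have h5 : s + 1 ≤ t / s := by
        rw [Nat.le_div_iff_mul_le hs]
        nlinarith
      -- With `u = t % s`, this yields `t = s (c + 1) + (s + 1) u`.
      obtain ⟨c, hc⟩ : ∃ c, t / s = t % s + (c + 1) := ⟨t / s - t % s - 1, by omega⟩
      rcases Nat.eq_zero_or_pos (t % s) with h6 | h6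
      · rw [← h3, h6, hc, h6, add_zero, zero_add]
        exact hmul s h1 c
      · obtain ⟨c', hc'⟩ : ∃ c', t % s = c' + 1 := ⟨t % s - 1, by omega⟩
        have h7 : t = s * (c + 1) + (s + 1) * (c' + 1) := by
          rw [← hc', ← h3, hc]
          simp only [Nat.mul_add_mod, Nat.mod_mod]
          ring_nf
        rw [h7]
        exact strictlyPos_pow_add_left hK (hmul s h1 c) (hmul _ h2 c').ne_zero
  refine ⟨∑ y, a y + ∑ y, b y + (s + 1) * (s + 1), by positivity, fun y z => ?_⟩
  have h3 : a y ≤ ∑ y, a y := Finset.single_le_sum (fun _ _ => Nat.zero_le _) (Finset.mem_univ y)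
  have h4 : b z ≤ ∑ y, b y := Finset.single_le_sum (fun _ _ => Nat.zero_le _) (Finset.mem_univ z)
  obtain ⟨t, ht⟩ : ∃ t, ∑ y, a y + ∑ y, b y + (s + 1) * (s + 1) = a y + (t + b z) :=
    ⟨∑ y, a y + ∑ y, b y + (s + 1) * (s + 1) - a y - b z, by omega⟩
  rw [ht]
  exact strictlyPos_pow_add_right hK (ha y)
    (strictlyPos_pow_add_left hK (hlarge t (by omega)) (hb z))

end Matrix

section Box

variable {m : Type*} [Fintype m] [DecidableEq m]

theorem natDegree_le_polyDegree {R : Type*} [Ring R] (B : Matrix m m R[X]) (i j : m) :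
    (B i j).natDegree ≤ polyDegree B :=
  ((Finset.le_sup (f := fun j => (B i j).natDegree) (Finset.mem_univ j)).trans
    (Finset.le_sup (f := fun i => Finset.univ.sup fun j => (B i j).natDegree)
      (Finset.mem_univ i))).trans (le_max_right _ _)

theorem polyDegree_eq {R : Type*} [Ring R] (B : Matrix m m R[X]) (d : ℕ) (hd : 1 ≤ d)
    (h : ∀ i j e, d < e → (B i j).coeff e = 0) {i j : m} (hij : (B i j).coeff d ≠ 0) :
    polyDegree B = d := by
  apply le_antisymm
  · refine max_le hd (Finset.sup_le fun i _ => Finset.sup_le fun j _ => ?_)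
    rw [natDegree_le_iff_coeff_eq_zero]
    exact fun e he => h i j e he
  · exact (le_natDegree_of_ne_zero hij).trans (natDegree_le_polyDegree B i j)

/-- A term of degree `e` of `B` is a path of length `e` in the box, descending through the blocks of
its target. The edges of full length `d` from `x` therefore pass through all blocks over every
vertex, which is why `hfrom` asks for the top coefficient. -/
theorem gprimitive_boxL {B : Matrix m m (ZG G)[X]} (hB : OverTPos B) (d : ℕ)
    (hd : ∀ i j e, d < e → (B i j).coeff e = 0) (x : m) (s : ℕ) (hs : 1 ≤ s)
    (h1 : StrictlyPos ((B x x).coeff s)) (h2 : StrictlyPos ((B x x).coeff (s + 1)))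
    (hto : ∀ y, Relation.ReflTransGen (fun i j => B i j ≠ 0) y x)
    (hfrom : ∀ y, (B x y).coeff d ≠ 0) : GPrimitive (boxL d B) := by
  have hK : ∀ i j, Nonneg (boxL d B i j) := by
    intro i j
    simp only [boxL, Matrix.of_apply]
    split_ifs
    · exact (hB _ _).2 _
    · exact Nonneg.one
    · exact Nonneg.zero
  have hsd : s + 1 ≤ d := by
    by_contra hc
    exact h2.ne_zero (hd _ _ _ (by omega))
  have h0d : 0 < d := by omega
  have hedge : ∀ (i j : m) (e : Fin d), (B i j).coeff (e + 1) ≠ 0 →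
      boxL d B (⟨0, h0d⟩, i) (e, j) ≠ 0 := by
    intro i j e h
    simpa [boxL] using h
  have hdown : ∀ (i : m) (c : ℕ) (hc : c < d),
      (boxL d B ^ c) (⟨c, hc⟩, i) (⟨0, h0d⟩, i) ≠ 0 := by
    intro i c
    induction c with
    | zero => intro hc; simp
    | succ c ih =>
      intro hc
      have h := pow_add_ne_zero hK (p := 1) (i := (⟨c + 1, hc⟩, i)) (by simp [boxL])
        (ih (by omega))
      rwa [add_comm 1 c] at h
  have hdown' : ∀ (i : m) (c c' : ℕ) (hc : c < d) (hc' : c' ≤ c),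
      Relation.ReflTransGen (fun x y => boxL d B x y ≠ 0) (⟨c, hc⟩, i) (⟨c', by omega⟩, i) := by
    intro i c c' hc hc'
    induction c, hc' using Nat.le_induction with
    | base => exact .refl
    | succ c hcc ih =>
      refine Relation.ReflTransGen.head ?_ (ih (by omega))
      simp [boxL]
  have hloop : ∀ t, 1 ≤ t → StrictlyPos ((B x x).coeff t) →
      StrictlyPos ((boxL d B ^ t) (⟨0, h0d⟩, x) (⟨0, h0d⟩, x)) := by
    intro t ht hp
    have htd : t ≤ d := by
      by_contra hc
      exact hp.ne_zero (hd _ _ _ (by omega))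
    obtain ⟨c, rfl⟩ : ∃ c, t = 1 + c := ⟨t - 1, by omega⟩
    refine strictlyPos_pow_add_left hK (j := (⟨c, by omega⟩, x)) ?_ (hdown x c (by omega))
    rw [pow_one]
    simpa [boxL, add_comm] using hp
  have hwalk : ∀ y z, Relation.ReflTransGen (fun i j => B i j ≠ 0) y z →
      Relation.ReflTransGen (fun x y => boxL d B x y ≠ 0) (⟨0, h0d⟩, y) (⟨0, h0d⟩, z) := by
    intro y z h
    induction h with
    | refl => exact .refl
    | @tail b c _ hbc ih =>
      refine ih.trans ?_
      obtain ⟨e, he⟩ : ∃ e, (B b c).coeff e ≠ 0 := by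
        by_contra hc
        push Not at hc
        exact hbc (Polynomial.ext (by simpa using hc))
      have he0 : e ≠ 0 := by
        rintro rfl
        exact he (hB _ _).1
      have hed : e ≤ d := by
        by_contra hc
        exact he (hd _ _ _ (by omega))
      refine Relation.ReflTransGen.head
        (hedge b c ⟨e - 1, by omega⟩ (by simpa [Nat.sub_add_cancel (Nat.pos_of_ne_zero he0)] using he)) ?_
      exact hdown' c (e - 1) 0 (by omega) (Nat.zero_le _)
  refine GPrimitive.of_loops hK (⟨0, h0d⟩, x) s (hloop s hs h1) (hloop _ (by omega) h2) ?_ ?_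
  · rintro ⟨⟨c, hc⟩, y⟩
    exact (hdown' y c 0 hc (Nat.zero_le _)).trans (hwalk y x (hto y))
  · rintro ⟨⟨c, hc⟩, y⟩
    refine Relation.ReflTransGen.head (hedge x y ⟨d - 1, by omega⟩ ?_)
      (hdown' y (d - 1) c (by omega) (by omega))
    simpa [Nat.sub_add_cancel h0d] using hfrom y

end Box

end Positivity

/-! ### Exponential growth of all coefficients of the powers of `A`. -/

section Growth

theorem exists_eigenvector_of_lt_spectralRadius {n : Type*} [Fintype n] [DecidableEq n]
    (M : Matrix n n ℂ) (β : ℝ) (hβ0 : 0 ≤ β) (hβ : β < (spectralRadius ℂ M).toReal) :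
    ∃ μ : ℂ, β < ‖μ‖ ∧ ∃ v : n → ℂ, v ≠ 0 ∧ M.mulVec v = μ • v := by
  have h1 : ENNReal.ofReal β < spectralRadius ℂ M := by
    by_contra hc
    push Not at hc
    have := ENNReal.toReal_mono ENNReal.ofReal_ne_top hc
    rw [ENNReal.toReal_ofReal hβ0] at this
    linarith
  simp only [spectralRadius, lt_iSup_iff] at h1
  obtain ⟨μ, hμ, h2⟩ := h1
  refine ⟨μ, ?_, ?_⟩
  · have h3 : ENNReal.ofReal β < ENNReal.ofReal ‖μ‖ := by
      rwa [ofReal_norm]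
    exact (ENNReal.ofReal_lt_ofReal_iff_of_nonneg hβ0).1 h3
  · rw [spectrum.mem_iff, Matrix.isUnit_iff_isUnit_det, isUnit_iff_ne_zero, not_not] at hμ
    obtain ⟨v, hv, h⟩ := Matrix.exists_mulVec_eq_zero_iff.2 hμ
    refine ⟨v, hv, ?_⟩
    rw [Matrix.sub_mulVec, sub_eq_zero, Algebra.algebraMap_eq_smul_one, Matrix.smul_mulVec,
      Matrix.one_mulVec] at h
    exact h.symm

/-- Take the row of a coordinate of `v` of maximal modulus, and compare that coordinate on both
sides of `M^s v = μ^s v`. -/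
theorem exists_row_norm_le {n : Type*} [Fintype n] [DecidableEq n] (M : Matrix n n ℂ) (μ : ℂ)
    (v : n → ℂ) (hv : v ≠ 0) (h : M.mulVec v = μ • v) :
    ∃ i, ∀ s : ℕ, ‖μ‖ ^ s ≤ ∑ j, ‖(M ^ s) i j‖ := by
  have hne : Nonempty n := by
    by_contra hc
    rw [not_nonempty_iff] at hc
    exact hv (Subsingleton.elim _ _)
  obtain ⟨i, -, hi⟩ := Finset.exists_max_image Finset.univ (fun i => ‖v i‖) Finset.univ_nonempty
  have hvi : 0 < ‖v i‖ := by
    rw [norm_pos_iff]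
    intro h0
    apply hv
    ext j
    have := hi j (Finset.mem_univ j)
    rw [h0, norm_zero] at this
    simpa using this
  refine ⟨i, fun s => ?_⟩
  have hs : (M ^ s).mulVec v = μ ^ s • v := by
    induction s with
    | zero => simp
    | succ s ih =>
      rw [pow_succ, ← Matrix.mulVec_mulVec, h, Matrix.mulVec_smul, ih, smul_smul, pow_succ,
        mul_comm]
  have h1 : ‖μ‖ ^ s * ‖v i‖ = ‖((M ^ s).mulVec v) i‖ := by
    rw [hs]; simp
  have h2 : ‖((M ^ s).mulVec v) i‖ ≤ (∑ j, ‖(M ^ s) i j‖) * ‖v i‖ := by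
    rw [Finset.sum_mul]
    refine (norm_sum_le _ _).trans (Finset.sum_le_sum fun j _ => ?_)
    rw [norm_mul]
    exact mul_le_mul_of_nonneg_left (hi j (Finset.mem_univ j)) (norm_nonneg _)
  rw [← h1] at h2
  exact le_of_mul_le_mul_right h2 hvi

variable {G : Type*} [Group G] [Fintype G] {n : Type*} [Fintype n] [DecidableEq n]

/-- An eigenvalue of modulus above `β` forces one row of the augmented powers to grow like `‖μ‖^s`.
A factor `A^p` on the right collects the row sum into a single entry, and one on the left spreads it
over all group elements. The loss of `2 p` in the exponent is absorbed by taking `γ` strictly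
between `β` and `‖μ‖`. -/
theorem GPrimitive.exists_growth {A : Matrix n n (ZG G)} (hA : GPrimitive A) {β : ℝ} (hβ0 : 0 < β)
    (hβ : β < specRadius A) : ∃ γ, β < γ ∧ ∃ m₀ : ℕ, ∀ s, m₀ ≤ s → ∀ i j g,
      γ ^ s ≤ (((A ^ s) i j).coeff g : ℝ) := by
  obtain ⟨hnn, p, hp, hpos⟩ := hA
  obtain ⟨μ, hμ, v, hv, hAv⟩ := exists_eigenvector_of_lt_spectralRadius _ β hβ0.le hβ
  obtain ⟨a, ha⟩ := exists_row_norm_le _ μ v hv hAv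
  have hpow := nonneg_matrix_pow hnn
  have hrow : ∀ s : ℕ, ‖μ‖ ^ s ≤ ∑ j, (aug ((A ^ s) a j) : ℝ) := by
    intro s
    refine (ha s).trans (Finset.sum_le_sum fun j _ => ?_)
    have h1 : (A.map fun x => ((aug x : ℤ) : ℂ)) ^ s =
        (A ^ s).map ((Int.castRingHom ℂ).comp aug) := by
      rw [Matrix.map_pow]
      rfl
    rw [h1]
    have h2 : ‖(((Int.castRingHom ℂ).comp aug) ((A ^ s) a j))‖ = |(aug ((A ^ s) a j) : ℝ)| := by
      simp
    rw [Matrix.map_apply, h2, abs_of_nonneg]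
    exact_mod_cast (hpow s a j).aug_nonneg
  have hbig : ∀ s i j g, ‖μ‖ ^ s ≤ (((A ^ (p + (s + p))) i j).coeff g : ℝ) := by
    intro s i j g
    have h1 : Nonneg ((A ^ (s + p)) a j) := hpow _ _ _
    have h2 : ((A ^ p) i a * (A ^ (s + p)) a j).coeff g ≤ ((A ^ (p + (s + p))) i j).coeff g := by
      rw [pow_add A p, Matrix.mul_apply, coeff_sum_apply]
      exact Finset.single_le_sum (f := fun l => ((A ^ p) i l * (A ^ (s + p)) l j).coeff g)
        (fun l _ => (hpow _ _ _).mul (hpow _ _ _) g) (Finset.mem_univ a)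
    have h3 := le_coeff_mul (c := 1) (fun g => by exact_mod_cast hpos i a g) h1 g
    have h4 : ∑ l, aug ((A ^ s) a l) ≤ aug ((A ^ (s + p)) a j) := by
      rw [pow_add, Matrix.mul_apply, map_sum]
      refine Finset.sum_le_sum fun l _ => ?_
      rw [map_mul]
      exact le_mul_of_one_le_right (hpow s a l).aug_nonneg
        ((hpos l j).nonneg.aug_pos (hpos l j).ne_zero)
    have h4' : ∑ l, (aug ((A ^ s) a l) : ℝ) ≤ (aug ((A ^ (s + p)) a j) : ℝ) := by exact_mod_cast h4
    have h2' : (((A ^ p) i a * (A ^ (s + p)) a j).coeff g : ℝ) ≤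
      (((A ^ (p + (s + p))) i j).coeff g : ℝ) := by exact_mod_cast h2
    linarith [hrow s]
  obtain ⟨γ, hγ1, hγ2⟩ := exists_between hμ
  have hγ0 : 0 < γ := hβ0.trans hγ1
  have hμ0 : 0 < ‖μ‖ := hγ0.trans hγ2
  have hlim := tendsto_pow_atTop_atTop_of_one_lt ((one_lt_div hγ0).2 hγ2)
  obtain ⟨m₀, hm₀⟩ := Filter.eventually_atTop.1 (hlim.eventually_ge_atTop (‖μ‖ ^ (2 * p)))
  refine ⟨γ, hγ1, max m₀ (2 * p), fun s hs i j g => ?_⟩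
  have h1 := hm₀ s ((le_max_left _ _).trans hs)
  have h2 : 2 * p ≤ s := (le_max_right _ _).trans hs
  obtain ⟨t, rfl⟩ : ∃ t, s = p + (t + p) := ⟨s - 2 * p, by omega⟩
  refine le_trans ?_ (hbig t i j g)
  rw [div_pow, le_div_iff₀ (by positivity)] at h1
  have h3 : ‖μ‖ ^ (p + (t + p)) = ‖μ‖ ^ (2 * p) * ‖μ‖ ^ t := by rw [← pow_add]; congr 1; ring
  rw [h3] at h1
  exact le_of_mul_le_mul_left h1 (by positivity)

end Growth

/-! ### Path counts, their growth, and the choice of the vertex `i₀`. -/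

section Paths

variable {G : Type*} [Group G] [Fintype G] {n : Type*} [Fintype n] [DecidableEq n]

/-- Some vertex is not the only predecessor of any vertex. -/
theorem GPrimitive.exists_not_unique_pred [Nontrivial n] {A : Matrix n n (ZG G)}
    (hA : GPrimitive A) : ∃ i₀, ∀ j, ∃ l, l ≠ i₀ ∧ A l j ≠ 0 := by
  obtain ⟨hnn, p, hp, hpos⟩ := hA
  by_contra hc
  push Not at hc
  -- If the claim fails, each `i` has a vertex `f i` with no predecessor other than `i`. Columns of
  -- `A` are nonzero, so `f` is injective, hence bijective, and every vertex has exactly one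
  -- predecessor.
  choose f hf using hc
  have hcol : ∀ j, ∃ l, A l j ≠ 0 := by
    intro j
    by_contra hc
    push Not at hc
    apply (hpos j j).ne_zero
    obtain ⟨q, rfl⟩ : ∃ q, p = q + 1 := ⟨p - 1, by omega⟩
    rw [pow_succ, Matrix.mul_apply]
    exact Finset.sum_eq_zero fun l _ => by rw [hc l, mul_zero]
  have hinj : Function.Injective f := by
    intro i i' h
    by_contra hne
    obtain ⟨l, hl⟩ := hcol (f i)
    have h1 : l = i := by
      by_contra h1
      exact hl (hf i l h1)
    have h2 : l = i' := by
      by_contra h2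
      exact hl (h ▸ hf i' l h2)
    exact hne (h1.symm.trans h2)
  have hsurj := Finite.surjective_of_injective hinj
  obtain ⟨g, hg⟩ := hsurj.hasRightInverse
  have huniq : ∀ l j, A l j ≠ 0 → l = g j := by
    intro l j h
    by_contra hne
    have := hf (g j) l hne
    rw [hg] at this
    exact h this
  -- Each column of each power then has at most one nonzero entry, which contradicts strict
  -- positivity when there are two vertices.
  have hpow : ∀ q l j, (A ^ q) l j ≠ 0 → l = g^[q] j := by
    intro q
    induction q with
    | zero =>
      intro l j h
      by_contra hne
      have hne' : l ≠ j := hne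
      exact h (by rw [pow_zero, Matrix.one_apply_ne hne'])
    | succ q ih =>
      intro l j h
      rw [pow_succ, Matrix.mul_apply] at h
      obtain ⟨x, -, hx⟩ := Finset.exists_ne_zero_of_sum_ne_zero h
      rw [Function.iterate_succ_apply, ← huniq x j (right_ne_zero_of_mul hx)]
      exact ih l x (left_ne_zero_of_mul hx)
  obtain ⟨x, y, hxy⟩ := exists_pair_ne n
  exact hxy ((hpow p x x (hpos x x).ne_zero).trans (hpow p y x (hpos y x).ne_zero).symm)

theorem nonneg_firstPass {A : Matrix n n (ZG G)} (hA : ∀ i j, Nonneg (A i j)) (i₀ : n) (e : ℕ)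
    (j : n) : Nonneg (firstPass A i₀ e j) := by
  induction e generalizing j with
  | zero => exact hA _ _
  | succ e ih =>
    refine Nonneg.sum fun l _ => ?_
    split_ifs
    · exact Nonneg.zero
    · exact (ih l).mul (hA _ _)

/-- Decomposition of paths at their last visit to `i₀`. -/
theorem pow_eq_sum_firstPass {R : Type*} [Ring R] (A : Matrix n n R) (i₀ : n) (s : ℕ) (j : n) :
    (A ^ (s + 1)) i₀ j = ∑ e ∈ Finset.range (s + 1), (A ^ (s - e)) i₀ i₀ * firstPass A i₀ e j := by
  induction s generalizing j with
  | zero => simp [firstPass]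
  | succ s ih =>
    rw [pow_succ, Matrix.mul_apply, Finset.sum_range_succ']
    have h1 : ∀ l, (A ^ (s + 1)) i₀ l * A l j =
        (if l = i₀ then (A ^ (s + 1)) i₀ i₀ * A i₀ j else 0) +
        if l = i₀ then 0 else (A ^ (s + 1)) i₀ l * A l j := by
      intro l
      split_ifs with h
      · rw [h, add_zero]
      · rw [zero_add]
    rw [Finset.sum_congr rfl fun l _ => h1 l, Finset.sum_add_distrib, add_comm]
    congr 1
    · simp only [firstPass, Finset.mul_sum]
      rw [Finset.sum_comm]
      refine Finset.sum_congr rfl fun l _ => ?_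
      split_ifs with h
      · simp
      · rw [ih l, Finset.sum_mul]
        refine Finset.sum_congr rfl fun e he => ?_
        rw [mul_assoc, show s + 1 - (e + 1) = s - e by omega]
    · simp [firstPass]

/-- Extend backwards from the end: `j` has a predecessor other than `i₀`, and a long path to that
predecessor avoiding `i₀` continues to `j`. -/
theorem exists_firstPass_ne_zero {A : Matrix n n (ZG G)} (hA : GPrimitive A) {i₀ : n}
    (hi₀ : ∀ j, ∃ l, l ≠ i₀ ∧ A l j ≠ 0) (E : ℕ) (j : n) :
    ∃ e, E ≤ e ∧ firstPass A i₀ e j ≠ 0 := by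
  obtain ⟨hnn, p, hp, hpos⟩ := hA
  induction E generalizing j with
  | zero =>
    obtain ⟨q, rfl⟩ : ∃ q, p = q + 1 := ⟨p - 1, by omega⟩
    have h := (hpos i₀ j).ne_zero
    rw [pow_eq_sum_firstPass] at h
    obtain ⟨e, -, he⟩ := Finset.exists_ne_zero_of_sum_ne_zero h
    exact ⟨e, Nat.zero_le _, right_ne_zero_of_mul he⟩
  | succ E ih =>
    obtain ⟨l, hl, hlj⟩ := hi₀ j
    obtain ⟨e, he, h⟩ := ih l
    refine ⟨e + 1, by omega, ?_⟩
    rw [firstPass]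
    have hfp := nonneg_firstPass hnn i₀
    refine Nonneg.sum_ne_zero (i := l) (fun x _ => ?_) (Finset.mem_univ l) ?_
    · split_ifs
      · exact Nonneg.zero
      · exact (hfp _ _).mul (hnn _ _)
    · rw [if_neg hl]
      exact (hfp _ _).mul_ne_zero (hnn _ _) h hlj

/-- The total weight of the paths from `i₀` of length `s` in the graph with weighted edge
lengths given by a polynomial matrix. -/
def pathSum {R : Type*} [Ring R] (C : Matrix n n R[X]) (i₀ : n) : ℕ → n → R
  | 0 => Pi.single i₀ 1
  | s + 1 => fun j => ∑ e : Fin (s + 1), ∑ l, pathSum C i₀ (s - e) l * (C l j).coeff (e + 1)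
termination_by s => s

theorem pathSum_zero {R : Type*} [Ring R] (C : Matrix n n R[X]) (i₀ : n) :
    pathSum C i₀ 0 = Pi.single i₀ 1 := by
  rw [pathSum]

theorem pathSum_succ {R : Type*} [Ring R] (C : Matrix n n R[X]) (i₀ : n) (s : ℕ) (j : n) :
    pathSum C i₀ (s + 1) j =
      ∑ e ∈ Finset.range (s + 1), ∑ l, pathSum C i₀ (s - e) l * (C l j).coeff (e + 1) := by
  rw [pathSum]
  exact Fin.sum_univ_eq_sum_range
    (fun e => ∑ l, pathSum C i₀ (s - e) l * (C l j).coeff (e + 1)) (s + 1)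

variable {C : Matrix n n (ZG G)[X]} {i₀ : n}

theorem nonneg_pathSum (hC : ∀ i j e, Nonneg ((C i j).coeff e)) (s : ℕ) (j : n) :
    Nonneg (pathSum C i₀ s j) := by
  induction s using Nat.strong_induction_on generalizing j with
  | _ s ih =>
    cases s with
    | zero =>
      rw [pathSum_zero]
      by_cases h : j = i₀
      · subst h
        rw [Pi.single_eq_same]
        exact Nonneg.one
      · rw [Pi.single_eq_of_ne h]
        exact Nonneg.zero
    | succ s =>
      rw [pathSum_succ]
      exact Nonneg.sum fun e _ => Nonneg.sum fun l _ => (ih _ (by omega) _).mul (hC _ _ _)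

/-- A closed path at `i₀` of length `m` followed by a path of length `t` is a path of length `m +
t`, and by nonnegativity the other paths only add to the count. -/
theorem pathSum_mul_le (hC : ∀ i j e, Nonneg ((C i j).coeff e)) (m t : ℕ) (j : n) :
    Nonneg (pathSum C i₀ (m + t) j - pathSum C i₀ m i₀ * pathSum C i₀ t j) := by
  induction t using Nat.strong_induction_on generalizing j with
  | _ t ih =>
    have hnn := nonneg_pathSum (i₀ := i₀) hC
    cases t with
    | zero =>
      rw [pathSum_zero, add_zero]
      by_cases h : j = i₀
      · subst h
        rw [Pi.single_eq_same, mul_one, sub_self]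
        exact Nonneg.zero
      · rw [Pi.single_eq_of_ne h, mul_zero, sub_zero]
        exact hnn _ _
    | succ t =>
      rw [← add_assoc, pathSum_succ, pathSum_succ,
        ← Finset.sum_range_add_sum_Ico _ (show t + 1 ≤ m + t + 1 by omega), add_sub_right_comm,
        Finset.mul_sum, ← Finset.sum_sub_distrib]
      refine Nonneg.add (Nonneg.sum fun e he => ?_)
        (Nonneg.sum fun e _ => Nonneg.sum fun l _ => (hnn _ _).mul (hC _ _ _))
      rw [Finset.mem_range] at he
      rw [Finset.mul_sum, ← Finset.sum_sub_distrib]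
      refine Nonneg.sum fun l _ => ?_
      rw [← mul_assoc, ← sub_mul, show m + t - e = m + (t - e) by omega]
      exact (ih _ (by omega) l).mul (hC _ _ _)

/-- By supermultiplicativity, closed paths of length `m₀` can be prepended, so the window from `m₀`
to `2 m₀` controls all larger lengths. -/
theorem le_coeff_pathSum (hC : ∀ i j e, Nonneg ((C i j).coeff e)) {γ : ℝ} (hγ : 0 < γ) {m₀ : ℕ}
    (hm₀ : 0 < m₀)
    (h : ∀ s, m₀ ≤ s → s ≤ 2 * m₀ → ∀ g, γ ^ s ≤ ((pathSum C i₀ s i₀).coeff g : ℝ)) (s : ℕ)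
    (hs : m₀ ≤ s) (g : G) : γ ^ s ≤ ((pathSum C i₀ s i₀).coeff g : ℝ) := by
  induction s using Nat.strong_induction_on generalizing g with
  | _ s ih =>
    rcases le_or_gt s (2 * m₀) with h1 | h1
    · exact h s hs h1 g
    · obtain ⟨t, rfl⟩ : ∃ t, s = m₀ + t := ⟨s - m₀, by omega⟩
      have h2 := pathSum_mul_le (i₀ := i₀) hC m₀ t i₀ g
      rw [MonoidAlgebra.coeff_sub, Finsupp.sub_apply, sub_nonneg] at h2
      have h3 := le_coeff_mul (h m₀ le_rfl (by omega)) (nonneg_pathSum (i₀ := i₀) hC t i₀) g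
      have h4 := ih t (by omega) (by omega) 1
      have h5 := (nonneg_pathSum (i₀ := i₀) hC t i₀).coeff_le_aug 1
      have h2' : ((pathSum C i₀ m₀ i₀ * pathSum C i₀ t i₀).coeff g : ℝ) ≤
          ((pathSum C i₀ (m₀ + t) i₀).coeff g : ℝ) := by exact_mod_cast h2
      have h5' : ((pathSum C i₀ t i₀).coeff 1 : ℝ) ≤ (aug (pathSum C i₀ t i₀) : ℝ) := by
        exact_mod_cast h5
      rw [pow_add]
      calc γ ^ m₀ * γ ^ t ≤ γ ^ m₀ * (aug (pathSum C i₀ t i₀) : ℝ) :=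
            mul_le_mul_of_nonneg_left (h4.trans h5') (by positivity)
        _ ≤ _ := h3.trans h2'

theorem pow_mul_aug_le_coeff_pathSum (hC : ∀ i j e, Nonneg ((C i j).coeff e)) {γ : ℝ} {m : ℕ}
    (h : ∀ g, γ ^ m ≤ ((pathSum C i₀ m i₀).coeff g : ℝ)) (t : ℕ) (j : n) (g : G) :
    γ ^ m * (aug (pathSum C i₀ t j) : ℝ) ≤ ((pathSum C i₀ (m + t) j).coeff g : ℝ) := by
  have h2 := pathSum_mul_le (i₀ := i₀) hC m t j g
  rw [MonoidAlgebra.coeff_sub, Finsupp.sub_apply, sub_nonneg] at h2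
  have h3 := le_coeff_mul h (nonneg_pathSum (i₀ := i₀) hC t j) g
  have h2' : ((pathSum C i₀ m i₀ * pathSum C i₀ t j).coeff g : ℝ) ≤
      ((pathSum C i₀ (m + t) j).coeff g : ℝ) := by exact_mod_cast h2
  exact h3.trans h2'

variable {A : Matrix n n (ZG G)} {q σ : ℕ}

/-- Every edge from `i₀` to another vertex has length `q + 1`. -/
theorem pathSum_eq_zero (hC2 : ∀ j, j ≠ i₀ → C i₀ j = monomial (q + 1) (firstPass A i₀ q j))
    (s : ℕ) (hs : s ≤ q) (j : n) (hj : j ≠ i₀) : pathSum C i₀ s j = 0 := by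
  induction s using Nat.strong_induction_on generalizing j with
  | _ s ih =>
    cases s with
    | zero => rw [pathSum_zero, Pi.single_eq_of_ne hj]
    | succ s =>
      rw [pathSum_succ]
      refine Finset.sum_eq_zero fun e he => Finset.sum_eq_zero fun l _ => ?_
      rw [Finset.mem_range] at he
      by_cases hl : l = i₀
      · rw [hl, hC2 j hj, coeff_monomial, if_neg (by omega), mul_zero]
      · rw [ih (s - e) (by omega) (by omega) l hl, zero_mul]

/-- So short a closed path consists of loops at `i₀`, and those loops are still the first-return
loops of `A`. Thus the deleted loops do not disturb the growth inherited from `A` on the initial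
window. -/
theorem pathSum_eq_pow (hC2 : ∀ j, j ≠ i₀ → C i₀ j = monomial (q + 1) (firstPass A i₀ q j))
    (hC3 : ∀ e, e < σ → (C i₀ i₀).coeff (e + 1) = firstPass A i₀ e i₀) (hσ : σ ≤ q) (s : ℕ)
    (hs : s ≤ σ) : pathSum C i₀ s i₀ = (A ^ s) i₀ i₀ := by
  induction s using Nat.strong_induction_on with
  | _ s ih =>
    cases s with
    | zero => rw [pathSum_zero, Pi.single_eq_same, pow_zero, Matrix.one_apply_eq]
    | succ s =>
      rw [pathSum_succ, pow_eq_sum_firstPass]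
      refine Finset.sum_congr rfl fun e he => ?_
      rw [Finset.mem_range] at he
      rw [Finset.sum_eq_single i₀, ih _ (by omega) (by omega), hC3 e (by omega)]
      · intro l _ hl
        rw [pathSum_eq_zero hC2 _ (by omega) l hl, zero_mul]
      · simp

/-- A path of `A` avoiding `i₀` after its start survives in `C`: its first `q + 1` steps form one
exit edge, and the remaining steps are edges of length one. -/
theorem pathSum_ge_firstPass (hA : ∀ i j, Nonneg (A i j))
    (hC : ∀ i j e, Nonneg ((C i j).coeff e))
    (hC1 : ∀ i j, i ≠ i₀ → C i j = monomial 1 (A i j))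
    (hC2 : ∀ j, j ≠ i₀ → C i₀ j = monomial (q + 1) (firstPass A i₀ q j)) (r : ℕ) (j : n)
    (hj : j ≠ i₀) : Nonneg (pathSum C i₀ (q + r + 1) j - firstPass A i₀ (q + r) j) := by
  have hnn := nonneg_pathSum (i₀ := i₀) hC
  induction r generalizing j with
  | zero =>
    rw [add_zero, pathSum_succ, Finset.sum_range_succ, Nat.sub_self, pathSum_zero,
      add_sub_assoc]
    refine Nonneg.add (Nonneg.sum fun e _ => Nonneg.sum fun l _ => (hnn _ _).mul (hC _ _ _)) ?_
    rw [Finset.sum_eq_single i₀, Pi.single_eq_same, one_mul, hC2 j hj, coeff_monomial, if_pos rfl,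
      sub_self]
    · exact Nonneg.zero
    · intro l _ hl
      rw [Pi.single_eq_of_ne hl, zero_mul]
    · simp
  | succ r ih =>
    rw [pathSum_succ, Finset.sum_range_succ', Nat.sub_zero, add_sub_assoc]
    refine Nonneg.add (Nonneg.sum fun e _ => Nonneg.sum fun l _ => (hnn _ _).mul (hC _ _ _)) ?_
    rw [← add_assoc, firstPass, ← Finset.sum_sub_distrib]
    refine Nonneg.sum fun l _ => ?_
    split_ifs with hl
    · rw [sub_zero]
      exact (hnn _ _).mul (hC _ _ _)
    · rw [hC1 l j hl, coeff_monomial, if_pos rfl, ← sub_mul]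
      exact (ih l hl).mul (hA _ _)

theorem exists_pathSum_ne_zero (hA : GPrimitive A) (hi₀ : ∀ j, ∃ l, l ≠ i₀ ∧ A l j ≠ 0)
    (hC : ∀ i j e, Nonneg ((C i j).coeff e))
    (hC1 : ∀ i j, i ≠ i₀ → C i j = monomial 1 (A i j))
    (hC2 : ∀ j, j ≠ i₀ → C i₀ j = monomial (q + 1) (firstPass A i₀ q j)) (j : n) :
    ∃ t, pathSum C i₀ t j ≠ 0 := by
  by_cases hj : j = i₀
  · refine ⟨0, ?_⟩
    rw [pathSum_zero, hj, Pi.single_eq_same]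
    exact one_ne_zero
  · obtain ⟨e, he, h⟩ := exists_firstPass_ne_zero hA hi₀ q j
    obtain ⟨r, rfl⟩ : ∃ r, e = q + r := ⟨e - q, by omega⟩
    refine ⟨q + r + 1, fun h0 => ?_⟩
    obtain ⟨g, hg⟩ := (nonneg_firstPass hA.1 i₀ (q + r) j).exists_pos h
    have h1 := pathSum_ge_firstPass hA.1 hC hC1 hC2 r j hj g
    rw [h0, zero_sub, MonoidAlgebra.coeff_neg, Finsupp.neg_apply] at h1
    omega

end Paths

/-! ### Deleting loops at `i₀`. -/

section Loops

variable {R : Type*} [Ring R] {k n : Type*} [Fintype k] [Fintype n] [DecidableEq n]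

/-- The edges to `i₀` of lengths `s a + 1` and weights `x a`. -/
def loopEdges (i₀ : n) (s : k → ℕ) (x : k → R) : Matrix k n R[X] :=
  Matrix.of fun a j => if j = i₀ then monomial (s a + 1) (x a) else 0

/-- The matrix whose row `i₀` is constant and whose other rows vanish. -/
def rowOnes (k : Type*) (i₀ : n) : Matrix n k R := Matrix.of fun i _ => if i = i₀ then 1 else 0

/-- The matrix `expandRow A i₀ q` after deletion of some loops at `i₀`. -/
def deleteLoops (A : Matrix n n R) (i₀ : n) (q : ℕ) (s : k → ℕ) (x : k → R) : Matrix n n R[X] :=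
  expandRow A i₀ q -
    ((rowOnes k i₀ : Matrix n k R).map Polynomial.C * loopEdges i₀ s x : Matrix n n R[X])

theorem mul_rowOnes {l : Type*} (M : Matrix l n R[X]) (i₀ : n) (i : l) (a : k) :
    (M * (rowOnes k i₀ : Matrix n k R).map Polynomial.C) i a = M i i₀ := by
  rw [Matrix.mul_apply, Finset.sum_eq_single i₀]
  · simp [rowOnes]
  · intro j _ hj
    simp [rowOnes, hj]
  · simp

theorem mul_loopEdges {l : Type*} (M : Matrix l k R[X]) (i₀ : n) (s : k → ℕ) (x : k → R) (i : l)
    (j : n) : (M * loopEdges i₀ s x) i j =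
      if j = i₀ then ∑ a, M i a * monomial (s a + 1) (x a) else 0 := by
  rw [Matrix.mul_apply]
  split_ifs with h <;> simp [loopEdges, h]

theorem deleteLoops_apply (A : Matrix n n R) (i₀ : n) (q : ℕ) (s : k → ℕ) (x : k → R) (i j : n) :
    deleteLoops A i₀ q s x i j = expandRow A i₀ q i j -
      if j = i₀ then (if i = i₀ then ∑ a, monomial (s a + 1) (x a) else 0) else 0 := by
  rw [deleteLoops, Matrix.sub_apply, mul_loopEdges]
  by_cases hi : i = i₀ <;> simp [rowOnes, hi]

variable {A : Matrix n n R} {i₀ : n} {q : ℕ} {s : k → ℕ} {x : k → R}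

theorem deleteLoops_apply_of_ne {i : n} (j : n) (hi : i ≠ i₀) :
    deleteLoops A i₀ q s x i j = monomial 1 (A i j) := by
  simp [deleteLoops_apply, expandRow, expandRowLoops, expandRowExit, hi]

theorem deleteLoops_apply_exit {j : n} (hj : j ≠ i₀) :
    deleteLoops A i₀ q s x i₀ j = monomial (q + 1) (firstPass A i₀ q j) := by
  simp [deleteLoops_apply, expandRow, expandRowLoops, expandRowExit, hj]

theorem coeff_deleteLoops_loop (e : ℕ) :
    (deleteLoops A i₀ q s x i₀ i₀).coeff (e + 1) =
      (if e ≤ q then firstPass A i₀ e i₀ else 0) - ∑ a, if s a = e then x a else 0 := by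
  simp [deleteLoops_apply, expandRow, expandRowLoops, expandRowExit, coeff_monomial]

theorem coeff_deleteLoops_zero (i j : n) : (deleteLoops A i₀ q s x i j).coeff 0 = 0 := by
  by_cases hi : i = i₀
  · by_cases hj : j = i₀
    · simp [hi, hj, deleteLoops_apply, expandRow, expandRowLoops, expandRowExit, coeff_monomial]
    · rw [hi, deleteLoops_apply_exit hj, coeff_monomial, if_neg (by omega)]
  · rw [deleteLoops_apply_of_ne j hi, coeff_monomial, if_neg (by omega)]

theorem coeff_deleteLoops_eq_zero (hs : ∀ a, s a ≤ q) (i j : n) (e : ℕ) (he : q + 1 < e) :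
    (deleteLoops A i₀ q s x i j).coeff e = 0 := by
  obtain ⟨e, rfl⟩ : ∃ c, e = c + 1 := ⟨e - 1, by omega⟩
  by_cases hi : i = i₀
  · by_cases hj : j = i₀
    · rw [hi, hj, coeff_deleteLoops_loop, if_neg (by omega), zero_sub, neg_eq_zero]
      refine Finset.sum_eq_zero fun a _ => ?_
      have := hs a
      rw [if_neg (by omega)]
    · rw [hi, deleteLoops_apply_exit hj, coeff_monomial, if_neg (by omega)]
  · rw [deleteLoops_apply_of_ne j hi, coeff_monomial, if_neg (by omega)]

theorem coeff_deleteLoops_of_lt {σ : ℕ} (hσ : ∀ a, σ ≤ s a) (hσq : σ ≤ q) (e : ℕ) (he : e < σ) :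
    (deleteLoops A i₀ q s x i₀ i₀).coeff (e + 1) = firstPass A i₀ e i₀ := by
  rw [coeff_deleteLoops_loop, if_pos (by omega), Finset.sum_eq_zero, sub_zero]
  intro a _
  have := hσ a
  rw [if_neg (by omega)]

end Loops

/-! ### Nonnegativity after deletion, and a supply of loops to delete. -/

section GroupLoops

variable {G : Type*} [Group G] {k n : Type*} [Fintype k] [Fintype n] [DecidableEq n]

/-- By injectivity of `s`, at most one term is removed in each degree, and `hg` says that this term
is present. -/
theorem nonneg_deleteLoops [Fintype G] {A : Matrix n n (ZG G)} (hA : ∀ i j, Nonneg (A i j))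
    {i₀ : n} {q : ℕ} {s : k → ℕ} (hs : Function.Injective s) (hsq : ∀ a, s a ≤ q) {g : k → G}
    (hg : ∀ a, 0 < (firstPass A i₀ (s a) i₀).coeff (g a)) (i j : n) (e : ℕ) :
    Nonneg ((deleteLoops A i₀ q s (fun a => MonoidAlgebra.single (g a) 1) i j).coeff e) := by
  have hmon : ∀ d e (x : ZG G), Nonneg x → Nonneg ((monomial d x).coeff e) := by
    intro d e x hx
    rw [coeff_monomial]
    split_ifs
    · exact hx
    · exact Nonneg.zero
  have hfp := nonneg_firstPass hA i₀
  by_cases hi : i = i₀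
  · by_cases hj : j = i₀
    · cases e with
      | zero =>
        rw [coeff_deleteLoops_zero]
        exact Nonneg.zero
      | succ e =>
        rw [hi, hj, coeff_deleteLoops_loop]
        by_cases h : ∃ a, s a = e
        · obtain ⟨a, rfl⟩ := h
          rw [if_pos (hsq a), Finset.sum_eq_single a, if_pos rfl]
          · classical
            intro h
            rw [MonoidAlgebra.coeff_sub, Finsupp.sub_apply, MonoidAlgebra.coeff_single,
              Finsupp.single_apply]
            split_ifs with hh
            · have := hg a
              rw [← hh]
              omega
            · rw [sub_zero]
              exact hfp _ _ _
          · intro b _ hb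
            rw [if_neg (fun h => hb (hs h))]
          · simp
        · push Not at h
          rw [Finset.sum_eq_zero (fun a _ => if_neg (h a)), sub_zero]
          split_ifs
          · exact hfp _ _
          · exact Nonneg.zero
    · rw [hi, deleteLoops_apply_exit hj]
      exact hmon _ _ _ (hfp _ _)
  · rw [deleteLoops_apply_of_ne j hi]
    exact hmon _ _ _ (hA _ _)

theorem GPrimitive.exists_loops [Fintype G] {A : Matrix n n (ZG G)} (hA : GPrimitive A) {i₀ : n}
    (hi₀ : ∀ j, ∃ l, l ≠ i₀ ∧ A l j ≠ 0) (k E : ℕ) : ∃ s : Fin k → ℕ, Function.Injective s ∧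
      (∀ a, E ≤ s a) ∧ ∃ g : Fin k → G, ∀ a, 0 < (firstPass A i₀ (s a) i₀).coeff (g a) := by
  have hinf : {e | E ≤ e ∧ firstPass A i₀ e i₀ ≠ 0}.Infinite := by
    refine Set.infinite_of_forall_exists_gt fun b => ?_
    obtain ⟨e, he, h⟩ := exists_firstPass_ne_zero hA hi₀ (E + b + 1) i₀
    exact ⟨e, ⟨by omega, h⟩, by omega⟩
  let f := hinf.natEmbedding
  choose g hg using fun a : Fin k =>
    (nonneg_firstPass hA.1 i₀ (f a : ℕ) i₀).exists_pos (f a).2.2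
  refine ⟨fun a => f a, fun a b h => ?_, fun a => (f a).2.1, g, hg⟩
  exact Fin.val_injective (f.injective (Subtype.val_injective h))

end GroupLoops

/-! ### Path counts with a prescribed initial edge. -/

section PathConv

variable {R : Type*} [Ring R] {n : Type*} [Fintype n] [DecidableEq n]

/-- The total weight of the paths of length `s` that start with an edge to `i₀` whose weighted
length is given by `y`. -/
def pathConv (C : Matrix n n R[X]) (i₀ : n) (y : R[X]) (s : ℕ) (j : n) : R :=
  ∑ m ∈ Finset.range (s + 1), y.coeff m * pathSum C i₀ (s - m) j

/-- Decomposition at the last edge: this is the coefficient form of `X = Y + X C`, which makes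
truncations of `X` almost satisfy the same equation. -/
theorem pathConv_rec (C : Matrix n n R[X]) (i₀ : n) (y : R[X]) (s : ℕ) (j : n) :
    pathConv C i₀ y s j = (if j = i₀ then y.coeff s else 0) +
      ∑ e ∈ Finset.range s, ∑ l, pathConv C i₀ y (s - 1 - e) l * (C l j).coeff (e + 1) := by
  rw [pathConv, Finset.sum_range_succ, add_comm, Nat.sub_self, pathSum_zero]
  congr 1
  · split_ifs with h
    · rw [h, Pi.single_eq_same, mul_one]
    · rw [Pi.single_eq_of_ne h, mul_zero]
  · have h1 : ∀ m ∈ Finset.range s, y.coeff m * pathSum C i₀ (s - m) j =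
        ∑ e ∈ Finset.range (s - m), ∑ l,
          y.coeff m * pathSum C i₀ (s - 1 - m - e) l * (C l j).coeff (e + 1) := by
      intro m hm
      rw [Finset.mem_range] at hm
      rw [show s - m = s - 1 - m + 1 by omega, pathSum_succ, Finset.mul_sum]
      refine Finset.sum_congr rfl fun e _ => ?_
      rw [Finset.mul_sum]
      exact Finset.sum_congr rfl fun l _ => (mul_assoc _ _ _).symm
    rw [Finset.sum_congr rfl h1, Finset.sum_comm' (t' := Finset.range s)
      (s' := fun e => Finset.range (s - e)) (by
        intro m e
        simp only [Finset.mem_range]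
        omega)]
    refine Finset.sum_congr rfl fun e he => ?_
    rw [Finset.mem_range] at he
    rw [Finset.sum_comm]
    refine Finset.sum_congr rfl fun l _ => ?_
    rw [pathConv, Finset.sum_mul, show s - 1 - e + 1 = s - e by omega]
    refine Finset.sum_congr rfl fun m _ => ?_
    rw [show s - 1 - m - e = s - 1 - e - m by omega]

theorem pathConv_sum {ι : Type*} [Fintype ι] (C : Matrix n n R[X]) (i₀ : n) (y : ι → R[X]) (s : ℕ)
    (j : n) : pathConv C i₀ (∑ b, y b) s j = ∑ b, pathConv C i₀ (y b) s j := by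
  simp only [pathConv, finsetSum_coeff, Finset.sum_mul]
  exact Finset.sum_comm

theorem pathConv_mul_monomial (C : Matrix n n R[X]) (i₀ : n) (p : R[X]) (c : ℕ) (x : R) (s : ℕ)
    (j : n) : pathConv C i₀ (p * monomial c x) s j =
      ∑ m ∈ Finset.range (s + 1 - c), p.coeff m * x * pathSum C i₀ (s - c - m) j := by
  have hco : ∀ m, (p * monomial c x).coeff m = if c ≤ m then p.coeff (m - c) * x else 0 := by
    intro m
    rw [← C_mul_X_pow_eq_monomial, ← mul_assoc, coeff_mul_X_pow', coeff_mul_C]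
  simp only [pathConv, hco]
  rcases le_or_gt c (s + 1) with h | h
  · obtain ⟨u, hu⟩ : ∃ u, s + 1 = c + u := ⟨s + 1 - c, by omega⟩
    rw [hu, Finset.sum_range_add, Finset.sum_eq_zero, zero_add, Nat.add_sub_cancel_left]
    · refine Finset.sum_congr rfl fun m _ => ?_
      rw [if_pos (by omega), Nat.add_sub_cancel_left, Nat.sub_sub]
    · intro m hm
      rw [Finset.mem_range] at hm
      rw [if_neg (by omega), zero_mul]
  · rw [show s + 1 - c = 0 by omega, Finset.range_zero, Finset.sum_empty]
    refine Finset.sum_eq_zero fun m hm => ?_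
    rw [Finset.mem_range] at hm
    rw [if_neg (by omega), zero_mul]

end PathConv

theorem sum_one_sub_mul {R k : Type*} [Ring R] [Fintype k] [DecidableEq k] (Q : Matrix k k R)
    (y : k → R) (a : k) : ∑ b, (1 - Q) a b * y b = y a + ∑ b, -Q a b * y b := by
  have h : ∀ b, (1 - Q) a b * y b = (1 : Matrix k k R) a b * y b + -Q a b * y b := by
    intro b
    rw [Matrix.sub_apply, sub_eq_add_neg, add_mul]
  rw [Finset.sum_congr rfl fun b _ => h b, Finset.sum_add_distrib, Finset.sum_eq_single a]
  · rw [Matrix.one_apply_eq, one_mul]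
  · intro b _ hb
    rw [Matrix.one_apply_ne hb.symm, zero_mul]
  · simp

theorem pathConv_add {R n : Type*} [Ring R] [Fintype n] [DecidableEq n] (C : Matrix n n R[X])
    (i₀ : n) (y y' : R[X]) (s : ℕ) (j : n) :
    pathConv C i₀ (y + y') s j = pathConv C i₀ y s j + pathConv C i₀ y' s j := by
  simp only [pathConv, coeff_add, add_mul, Finset.sum_add_distrib]

theorem pathConv_monomial {R n : Type*} [Ring R] [Fintype n] [DecidableEq n] (C : Matrix n n R[X])
    (i₀ : n) (c : ℕ) (x : R) (s : ℕ) (j : n) : pathConv C i₀ (monomial (c + 1) x) s j =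
      x * if c < s then pathSum C i₀ (s - 1 - c) j else 0 := by
  rw [← one_mul (monomial (c + 1) x), pathConv_mul_monomial]
  split_ifs with hst
  · rw [show s + 1 - (c + 1) = (s - 1 - c) + 1 by omega, Finset.sum_range_succ',
      Finset.sum_eq_zero, zero_add, coeff_one_zero, one_mul, Nat.sub_zero,
      show s - (c + 1) = s - 1 - c by omega]
    intro m _
    rw [coeff_one, if_neg (by omega), zero_mul, zero_mul]
  · rw [show s + 1 - (c + 1) = 0 by omega, Finset.range_zero, Finset.sum_empty, mul_zero]

/-! ### The contribution of `Q` is dominated by the leading term. -/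

section Estimate

variable {G : Type*} [Group G] [Fintype G] {k n : Type*} [Fintype k] [DecidableEq k] [Fintype n]
  [DecidableEq n]

theorem abs_coeff_mul_le {x y : ZG G} {c : ℝ} (hx : ∀ g, |(x.coeff g : ℝ)| ≤ c) (hy : Nonneg y)
    (g : G) : |((x * y).coeff g : ℝ)| ≤ c * (aug y : ℝ) := by
  rw [coeff_mul_eq_sum', aug_eq_sum]
  push_cast
  rw [Finset.mul_sum]
  refine (Finset.abs_sum_le_sum_abs _ _).trans (Finset.sum_le_sum fun h _ => ?_)
  have h1 : (0 : ℝ) ≤ (y.coeff h : ℝ) := by exact_mod_cast hy h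
  rw [abs_mul, abs_of_nonneg h1]
  exact mul_le_mul_of_nonneg_right (hx _) h1

variable {C : Matrix n n (ZG G)[X]} {i₀ : n} {β γ : ℝ} {m₀ r M : ℕ}

/-- The augmentation of a path count bounds every coefficient of a longer one, so the coefficients
at `h` and `h'` can be compared although they are unrelated. The term of degree `m` of `p` costs
`β^m` and prolonging the path gains at least `γ^(m - M)`; summing over `m ≥ r` gives the geometric
tail. -/
theorem abs_coeff_pathConv_le (hC : ∀ i j e, Nonneg ((C i j).coeff e)) (hβ : 0 < β) (hγ : 1 ≤ γ)
    (hβγ : β < γ) (hz : ∀ m, m₀ ≤ m → ∀ g, γ ^ m ≤ ((pathSum C i₀ m i₀).coeff g : ℝ))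
    (hr : M + m₀ < r) {p : (ZG G)[X]} (hp : ∀ m g, |((p.coeff m).coeff g : ℝ)| ≤ β ^ m)
    (hpr : ∀ m < r, p.coeff m = 0) (x : G) {c d : ℕ} (hd : d ≤ M) (t : ℕ) (j : n)
    (h h' : G) :
    |((pathConv C i₀ (p * monomial (c + 1) (MonoidAlgebra.single x 1)) t j).coeff h : ℝ)| ≤
      γ ^ M * ((β / γ) ^ r / (1 - β / γ)) *
        ((if d < t then pathSum C i₀ (t - 1 - d) j else 0 : ZG G).coeff h' : ℝ) := by
  have hγ0 : 0 < γ := one_pos.trans_le hγ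
  have hnn := nonneg_pathSum (i₀ := i₀) hC
  have hx0 : 0 ≤ β / γ := by positivity
  have hx1 : β / γ < 1 := (div_lt_one hγ0).2 hβγ
  rw [pathConv_mul_monomial, show t + 1 - (c + 1) = t - c by omega]
  have hzero : ∀ m < r,
      p.coeff m * MonoidAlgebra.single x 1 * pathSum C i₀ (t - (c + 1) - m) j = 0 := by
    intro m hm
    rw [hpr m hm, zero_mul, zero_mul]
  rcases le_or_gt (t - c) r with htr | htr
  · rw [Finset.sum_eq_zero fun m hm => hzero m (by rw [Finset.mem_range] at hm; omega)]
    have h1 : (0 : ℝ) ≤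
        ((if d < t then pathSum C i₀ (t - 1 - d) j else 0 : ZG G).coeff h' : ℝ) := by
      split_ifs
      · exact_mod_cast hnn _ _ _
      · simp
    have h2 : 0 < 1 - β / γ := by linarith
    rw [MonoidAlgebra.coeff_zero, Finsupp.zero_apply, Int.cast_zero, abs_zero]
    positivity
  · rw [if_pos (by omega), ← Finset.sum_range_add_sum_Ico _ htr.le,
      Finset.sum_eq_zero fun m hm => hzero m (by rwa [Finset.mem_range] at hm), zero_add,
      coeff_sum_apply]
    push_cast
    have hZ : (0 : ℝ) ≤ ((pathSum C i₀ (t - 1 - d) j).coeff h' : ℝ) := by exact_mod_cast hnn _ _ _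
    refine (Finset.abs_sum_le_sum_abs _ _).trans ?_
    have hterm : ∀ m ∈ Finset.Ico r (t - c),
        |((p.coeff m * MonoidAlgebra.single x 1 * pathSum C i₀ (t - (c + 1) - m) j).coeff h : ℝ)| ≤
          (β / γ) ^ m * (γ ^ M * ((pathSum C i₀ (t - 1 - d) j).coeff h' : ℝ)) := by
      intro m hm
      rw [Finset.mem_Ico] at hm
      set z := pathSum C i₀ (t - (c + 1) - m) j with hzdef
      have h1 := abs_coeff_mul_le (x := p.coeff m * MonoidAlgebra.single x 1) (y := z) (c := β ^ m)
        (fun g => by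
          rw [MonoidAlgebra.coeff_mul_single_apply, mul_one]
          exact hp _ _) (hnn _ _) h
      -- Total length `t - 1 - d` is split into a closed path of length `m + c - d` and the given
      -- remainder. The closed part has length at least `m₀` because `m ≥ r > M + m₀` and `d ≤ M`.
      have h2 := pow_mul_aug_le_coeff_pathSum hC (hz (m + c - d) (by omega))
        (t - (c + 1) - m) j h'
      rw [← hzdef, show m + c - d + (t - (c + 1) - m) = t - 1 - d by omega] at h2
      have h3 : γ ^ m ≤ γ ^ M * γ ^ (m + c - d) := by
        rw [← pow_add]
        exact pow_le_pow_right₀ hγ (by omega)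
      have h4 : (0 : ℝ) ≤ (aug z : ℝ) := by exact_mod_cast (hnn _ _).aug_nonneg
      refine h1.trans ?_
      have h5 : β ^ m = (β / γ) ^ m * γ ^ m := by
        rw [div_pow, div_mul_cancel₀ _ (by positivity)]
      rw [h5, mul_assoc]
      refine mul_le_mul_of_nonneg_left ?_ (by positivity)
      calc γ ^ m * (aug z : ℝ) ≤ γ ^ M * γ ^ (m + c - d) * (aug z : ℝ) :=
            mul_le_mul_of_nonneg_right h3 h4
        _ = γ ^ M * (γ ^ (m + c - d) * (aug z : ℝ)) := mul_assoc _ _ _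
        _ ≤ _ := mul_le_mul_of_nonneg_left h2 (by positivity)
    refine (Finset.sum_le_sum hterm).trans ?_
    rw [← Finset.sum_mul]
    have hgeo := geom_sum_Ico_le_of_lt_one (m := r) (n := t - c) hx0 hx1
    calc _ ≤ (β / γ) ^ r / (1 - β / γ) * (γ ^ M * ((pathSum C i₀ (t - 1 - d) j).coeff h' : ℝ)) :=
          mul_le_mul_of_nonneg_right hgeo (by positivity)
      _ = _ := by ring

/-- The identity part of `1 - Q` contributes the leading count translated by `g a`. Each of the
`card k` summands from `Q` is an error bounded by the previous lemma with `d = s a`, and `hr2`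
limits their sum to one half. -/
theorem half_le_coeff_pathConv (hC : ∀ i j e, Nonneg ((C i j).coeff e)) (hβ : 0 < β) (hγ : 1 ≤ γ)
    (hβγ : β < γ) (hz : ∀ m, m₀ ≤ m → ∀ g, γ ^ m ≤ ((pathSum C i₀ m i₀).coeff g : ℝ))
    (hr : M + m₀ < r) (hr2 : Fintype.card k * (γ ^ M * ((β / γ) ^ r / (1 - β / γ))) ≤ 1 / 2)
    {s : k → ℕ} (hs : ∀ a, s a ≤ M) (g : k → G) {Q : Matrix k k (ZG G)[X]}
    (hQ : ∀ i j m g, |((((Q i j).coeff m).coeff g : ℤ) : ℝ)| ≤ β ^ m)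
    (hQr : ∀ i j, ∀ m < r, (Q i j).coeff m = 0) (a : k) (t : ℕ) (j : n) (h : G) :
    1 / 2 * ((if s a < t then pathSum C i₀ (t - 1 - s a) j else 0 : ZG G).coeff
        ((g a)⁻¹ * h) : ℝ) ≤
      ((pathConv C i₀ (∑ b, (1 - Q) a b * monomial (s b + 1) (MonoidAlgebra.single (g b) 1)) t
        j).coeff h : ℝ) := by
  have hnn := nonneg_pathSum (i₀ := i₀) hC
  set Z := (if s a < t then pathSum C i₀ (t - 1 - s a) j else 0 : ZG G) with hZdef
  rw [sum_one_sub_mul, pathConv_add, pathConv_monomial, ← hZdef, pathConv_sum,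
    MonoidAlgebra.coeff_add, Finsupp.add_apply, coeff_single_mul', coeff_sum_apply]
  push_cast
  have herr : ∀ b, |((pathConv C i₀ (-Q a b * monomial (s b + 1)
      (MonoidAlgebra.single (g b) (1 : ℤ))) t j).coeff h : ℝ)| ≤
        γ ^ M * ((β / γ) ^ r / (1 - β / γ)) * (Z.coeff ((g a)⁻¹ * h) : ℝ) := by
    intro b
    refine abs_coeff_pathConv_le hC hβ hγ hβγ hz hr (fun m g => ?_) (fun m hm => ?_) _ (hs a) _ _ _
      _
    · rw [coeff_neg, MonoidAlgebra.coeff_neg, Finsupp.neg_apply, Int.cast_neg, abs_neg]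
      exact hQ _ _ _ _
    · rw [coeff_neg, hQr _ _ _ hm, neg_zero]
  have hZ : (0 : ℝ) ≤ (Z.coeff ((g a)⁻¹ * h) : ℝ) := by
    rw [hZdef]
    split_ifs
    · exact_mod_cast hnn _ _ _
    · simp
  have hsum := (Finset.abs_sum_le_sum_abs _ _).trans
    (Finset.sum_le_sum fun b (_ : b ∈ Finset.univ) => herr b)
  rw [Finset.sum_const, Finset.card_univ, nsmul_eq_mul, ← mul_assoc] at hsum
  have h1 := (abs_le.1 (hsum.trans (mul_le_mul_of_nonneg_right hr2 hZ))).1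
  linarith

end Estimate

/-! ### Truncated path series. -/

section Truncation

variable {R : Type*} [Ring R] {k n : Type*} [Fintype k] [Fintype n] [DecidableEq n]

/-- The edges to `i₀` with weighted lengths `y`. -/
def startEdges (i₀ : n) (y : k → R[X]) : Matrix k n R[X] :=
  Matrix.of fun a j => if j = i₀ then y a else 0

/-- The generating polynomials of the paths that start with an edge in `y`, for the lengths up to
`N`, or up to `N - q` for the paths that end at `i₀`. -/
def truncPaths (C : Matrix n n R[X]) (i₀ : n) (q N : ℕ) (y : k → R[X]) : Matrix k n R[X] :=
  Matrix.of fun a j =>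
    ∑ s ∈ Finset.range ((if j = i₀ then N - q else N) + 1), monomial s (pathConv C i₀ (y a) s j)

theorem coeff_startEdges (i₀ : n) (y : k → R[X]) (a : k) (j : n) (s : ℕ) :
    (startEdges i₀ y a j).coeff s = if j = i₀ then (y a).coeff s else 0 := by
  by_cases h : j = i₀ <;> simp [startEdges, h]

theorem coeff_truncPaths (C : Matrix n n R[X]) (i₀ : n) (q N : ℕ) (y : k → R[X]) (a : k) (j : n)
    (s : ℕ) : (truncPaths C i₀ q N y a j).coeff s =
      if s ≤ (if j = i₀ then N - q else N) then pathConv C i₀ (y a) s j else 0 := by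
  simp only [truncPaths, Matrix.of_apply, finsetSum_coeff, coeff_monomial]
  rw [Finset.sum_ite_eq']
  simp only [Finset.mem_range, Nat.lt_succ_iff]

theorem coeff_matrix_mul_of_coeff_zero {l : Type*} {C : Matrix n n R[X]}
    (hC0 : ∀ i j, (C i j).coeff 0 = 0) (M : Matrix l n R[X]) (i : l) (j : n) (s : ℕ) :
    ((M * C) i j).coeff s =
      ∑ e ∈ Finset.range s, ∑ x, (M i x).coeff (s - 1 - e) * (C x j).coeff (e + 1) := by
  rw [Matrix.mul_apply, finsetSum_coeff, Finset.sum_comm]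
  refine Finset.sum_congr rfl fun x _ => ?_
  rw [coeff_mul, Finset.Nat.sum_antidiagonal_eq_sum_range_succ_mk, Finset.sum_range_succ,
    Nat.sub_self, hC0,
    mul_zero, add_zero, ← Finset.sum_range_reflect]
  refine Finset.sum_congr rfl fun e he => ?_
  rw [Finset.mem_range] at he
  rw [show s - (s - 1 - e) = e + 1 by omega]

variable {C : Matrix n n R[X]} {i₀ : n} {q N : ℕ} {y : k → R[X]}

/-- Cutting off at `N - q` for paths ending at `i₀` loses nothing in these degrees: `i₀` is left for
other vertices only by edges of length `q + 1`, which reach exactly `N + 1`. -/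
theorem coeff_startEdges_add (hC0 : ∀ i j, (C i j).coeff 0 = 0)
    (hC2 : ∀ j e, j ≠ i₀ → e ≠ q → (C i₀ j).coeff (e + 1) = 0) (a : k) (j : n) (s : ℕ)
    (hs : s ≤ N + 1) (hs' : j = i₀ → s ≤ N - q + 1) :
    ((startEdges i₀ y + truncPaths C i₀ q N y * C : Matrix k n R[X]) a j).coeff s =
      pathConv C i₀ (y a) s j := by
  rw [Matrix.add_apply, coeff_add, coeff_startEdges, pathConv_rec,
    coeff_matrix_mul_of_coeff_zero hC0]
  congr 1
  refine Finset.sum_congr rfl fun e he => Finset.sum_congr rfl fun x _ => ?_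
  rw [Finset.mem_range] at he
  rw [coeff_truncPaths]
  by_cases hx : x = i₀
  · rw [if_pos hx]
    split_ifs with h
    · rfl
    · by_cases hj : j = i₀
      · have := hs' hj
        omega
      · rw [hx, hC2 j e hj (by omega), mul_zero, mul_zero]
  · rw [if_neg hx, if_pos (by omega)]

theorem coeff_truncPaths_mul_eq_zero (hqN : q ≤ N) (hC0 : ∀ i j, (C i j).coeff 0 = 0)
    (hC1 : ∀ i j e, i ≠ i₀ → e ≠ 0 → (C i j).coeff (e + 1) = 0)
    (hCd : ∀ i j e, q + 1 < e → (C i j).coeff e = 0) (a : k) (j : n) (s : ℕ) (hs : N + 1 < s) :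
    ((truncPaths C i₀ q N y * C : Matrix k n R[X]) a j).coeff s = 0 := by
  rw [coeff_matrix_mul_of_coeff_zero hC0]
  refine Finset.sum_eq_zero fun e he => Finset.sum_eq_zero fun x _ => ?_
  rw [Finset.mem_range] at he
  rw [coeff_truncPaths]
  by_cases hx : x = i₀
  · rw [if_pos hx]
    split_ifs with h
    · rw [hCd _ _ _ (by omega), mul_zero]
    · rw [zero_mul]
  · rw [if_neg hx]
    split_ifs with h
    · rw [hC1 _ _ _ hx (by omega), mul_zero]
    · rw [zero_mul]

theorem coeff_startEdges_sub (a : k) (j : n) (s : ℕ) :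
    ((startEdges i₀ y - truncPaths C i₀ q N y * (1 - C) : Matrix k n R[X]) a j).coeff s =
      ((startEdges i₀ y + truncPaths C i₀ q N y * C : Matrix k n R[X]) a j).coeff s -
        (truncPaths C i₀ q N y a j).coeff s := by
  have h : startEdges i₀ y - truncPaths C i₀ q N y * (1 - C) =
      (startEdges i₀ y + truncPaths C i₀ q N y * C) - truncPaths C i₀ q N y := by
    rw [Matrix.mul_sub, Matrix.mul_one]
    abel
  rw [h, Matrix.sub_apply, coeff_sub]

/-- Below the cut the recursion for path counts cancels everything. Above it neither `y` nor the
truncated series has a term, so only the product with `C` remains; this gives nonnegativity without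
further estimates. -/
theorem coeff_startEdges_sub_eq (hC0 : ∀ i j, (C i j).coeff 0 = 0)
    (hC2 : ∀ j e, j ≠ i₀ → e ≠ q → (C i₀ j).coeff (e + 1) = 0)
    (hy : ∀ a e, N - q < e → (y a).coeff e = 0) (a : k) (j : n) (s : ℕ) :
    ((startEdges i₀ y - truncPaths C i₀ q N y * (1 - C) : Matrix k n R[X]) a j).coeff s =
      if s ≤ (if j = i₀ then N - q else N) then 0 else
        ((truncPaths C i₀ q N y * C : Matrix k n R[X]) a j).coeff s := by
  rw [coeff_startEdges_sub, coeff_truncPaths]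
  by_cases hj : j = i₀
  · rw [if_pos hj]
    split_ifs with h
    · rw [coeff_startEdges_add hC0 hC2 a j s (by omega) (fun _ => by omega), sub_self]
    · rw [sub_zero, Matrix.add_apply, coeff_add, coeff_startEdges, if_pos hj, hy _ _ (by omega),
        zero_add]
  · rw [if_neg hj]
    split_ifs with h
    · rw [coeff_startEdges_add hC0 hC2 a j s (by omega) (fun h => absurd h hj), sub_self]
    · rw [sub_zero, Matrix.add_apply, coeff_add, coeff_startEdges, if_neg hj, zero_add]

end Truncation

/-! ### Augmentation and relabelling of box matrices. -/

section BoxMap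

theorem map_boxL {R R' : Type*} [Ring R] [Ring R'] (f : R →+* R') {m : Type*} [DecidableEq m]
    (L : ℕ) (B : Matrix m m R[X]) : (boxL L B).map f = boxL L (B.map (mapRingHom f)) := by
  ext x y
  simp only [boxL, Matrix.map_apply, Matrix.of_apply, coe_mapRingHom, coeff_map]
  split_ifs <;> simp

theorem gprimitive_box_of_eq {G : Type*} [Group G] {m : Type*} [Fintype m] [DecidableEq m]
    {B : Matrix m m (ZG G)[X]} {d : ℕ} (hd : polyDegree B = d) (h : GPrimitive (boxL d B)) :
    GPrimitive (box B) := by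
  subst hd
  exact h

theorem sse_box_of_eq {G : Type*} [Group G] {m n : Type} [Fintype m] [DecidableEq m] [Fintype n]
    {B : Matrix m m (ZG G)[X]} {A : Matrix n n ℤ} {d : ℕ} (hd : polyDegree B = d)
    (h : SSE {x : ℤ | 0 ≤ x} A (boxL d (B.map augPoly))) :
    SSE {x : ℤ | 0 ≤ x} ((box B).map aug) A := by
  subst hd
  rw [box_eq_boxL, map_boxL]
  exact h.symm'

theorem GPrimitive.submatrix {G : Type*} [Group G] {m n : Type*} [Fintype m] [DecidableEq m]
    [Fintype n] [DecidableEq n] {A : Matrix n n (ZG G)} (hA : GPrimitive A) (e : m ≃ n) :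
    GPrimitive (A.submatrix e e) := by
  obtain ⟨h, p, hp, hpos⟩ := hA
  have hpow : ∀ q : ℕ, A.submatrix e e ^ q = (A ^ q).submatrix e e := by
    intro q
    induction q with
    | zero => rw [pow_zero, pow_zero, Matrix.submatrix_one_equiv]
    | succ q ih => rw [pow_succ, ih, Matrix.submatrix_mul_equiv, ← pow_succ]
  refine ⟨fun i j => h _ _, p, hp, fun i j => ?_⟩
  rw [hpow]
  exact hpos _ _

theorem ElEquiv.refl' {R : Type*} [Ring R] {m : Type*} [Fintype m] [DecidableEq m]
    (M : Matrix m m R) : ElEquiv M M :=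
  ⟨0, 1, one_mem _, 1, one_mem _, by rw [one_mul, mul_one]⟩

end BoxMap

/-! ### The case `k = 0`. -/

section Trivial

variable {G : Type*} [Group G] [Fintype G] {n : Type} [Fintype n] [DecidableEq n]

/-- The case of an empty block. -/
theorem exists_extension_of_isEmpty {A : Matrix n n (ZG G)} (hA : GPrimitive A) (i₀ : n)
    (Q : Matrix (Fin 0) (Fin 0) (ZG G)[X]) : ∃ B : Matrix (Fin 0 ⊕ n) (Fin 0 ⊕ n) (ZG G)[X],
      ElEquiv (Matrix.fromBlocks (1 - Q) 0 0 (1 - tMul A)) (1 - B) ∧ OverTPos B ∧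
        GPrimitive (box B) ∧ SSE {x : ℤ | 0 ≤ x} ((box B).map aug) (A.map aug) := by
  have hdeg : polyDegree (Matrix.fromBlocks (0 : Matrix (Fin 0) (Fin 0) (ZG G)[X]) 0 0
      (tMul A)) = 1 := by
    refine le_antisymm (max_le le_rfl (Finset.sup_le fun i _ => Finset.sup_le fun j _ => ?_))
      (le_max_left _ _)
    rcases i with i | i
    · exact i.elim0
    · rcases j with j | j
      · exact j.elim0
      · exact natDegree_monomial_le _
  refine ⟨Matrix.fromBlocks 0 0 0 (tMul A), ?_, ?_, gprimitive_box_of_eq hdeg ?_,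
    sse_box_of_eq hdeg ?_⟩
  · have h : Matrix.fromBlocks (1 - Q) 0 0 (1 - tMul A) =
        1 - Matrix.fromBlocks (0 : Matrix (Fin 0) (Fin 0) (ZG G)[X]) 0 0 (tMul A) := by
      ext1 i j
      rcases i with i | i
      · exact i.elim0
      rcases j with j | j
      · exact j.elim0
      simp [Matrix.one_apply]
    rw [h]
    exact ElEquiv.refl' _
  · rintro (i | i) (j | j)
    · exact i.elim0
    · exact i.elim0
    · exact j.elim0
    · simp only [Matrix.fromBlocks_apply₂₂, tMul, Matrix.map_apply, coeff_monomial]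
      refine ⟨if_neg (by omega), fun s => ?_⟩
      split_ifs
      · exact hA.1 _ _
      · exact Nonneg.zero
  · have := hA.submatrix ((Equiv.uniqueProd (Fin 0 ⊕ n) (Fin 1)).trans (Equiv.emptySum (Fin 0) n))
    convert this using 1
    ext1 ⟨a, i⟩ ⟨b, j⟩
    rcases i with i | i
    · exact i.elim0
    rcases j with j | j
    · exact j.elim0
    simp [boxL, tMul]
  · have := sse_expandRow (k := Fin 0) (A.map aug) (fun i j => (hA.1 i j).aug_nonneg) i₀ 0 1 le_rfl
    rw [← map_expandRow, expandRow_zero] at this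
    convert this using 2
    rw [Matrix.fromBlocks_map]
    congr 1
    · exact Subsingleton.elim _ _
    · exact Subsingleton.elim _ _
    · exact Subsingleton.elim _ _

end Trivial

/-! ### Construction of `B`. -/

section Extension

variable {G : Type*} [Group G] [Fintype G] {k n : Type} [Fintype k] [DecidableEq k] [Fintype n]
  [DecidableEq n]

theorem coeff_matrix_mul_nonneg_zg {l m n : Type*} [Fintype m] {M : Matrix l m (ZG G)[X]}
    {N : Matrix m n (ZG G)[X]} (hM : ∀ i j e, Nonneg ((M i j).coeff e))
    (hN : ∀ i j e, Nonneg ((N i j).coeff e)) (i j) (e : ℕ) : Nonneg (((M * N) i j).coeff e) := by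
  rw [Matrix.mul_apply, finsetSum_coeff]
  refine Nonneg.sum fun x _ => ?_
  rw [coeff_mul]
  exact Nonneg.sum fun y _ => (hM _ _ _).mul (hN _ _ _)

/-- Every path count is eventually strictly positive. -/
theorem exists_strictlyPos_pathSum {C : Matrix n n (ZG G)[X]} {i₀ : n}
    (hC : ∀ i j e, Nonneg ((C i j).coeff e)) {γ : ℝ} (hγ : 0 < γ) {m₀ : ℕ}
    (hz : ∀ m, m₀ ≤ m → ∀ g, γ ^ m ≤ ((pathSum C i₀ m i₀).coeff g : ℝ))
    (hne : ∀ j, ∃ t, pathSum C i₀ t j ≠ 0) :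
    ∃ T, ∀ t, T ≤ t → ∀ j, StrictlyPos (pathSum C i₀ t j) := by
  choose t₀ ht₀ using hne
  refine ⟨m₀ + ∑ j, t₀ j, fun t ht j g => ?_⟩
  have h1 : t₀ j ≤ ∑ j, t₀ j :=
    Finset.single_le_sum (fun _ _ => Nat.zero_le _) (Finset.mem_univ j)
  have h2 := pow_mul_aug_le_coeff_pathSum hC (hz (t - t₀ j) (by omega)) (t₀ j) j g
  rw [Nat.sub_add_cancel (by omega)] at h2
  have h3 : (0 : ℝ) < (aug (pathSum C i₀ (t₀ j) j) : ℝ) := by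
    exact_mod_cast (nonneg_pathSum hC _ _).aug_pos (ht₀ j)
  have h4 : (0 : ℝ) < ((pathSum C i₀ t j).coeff g : ℝ) := (mul_pos (pow_pos hγ _) h3).trans_le h2
  exact_mod_cast h4

theorem exists_loop_ne_zero {C : Matrix n n (ZG G)[X]} {i₀ : n} {A : Matrix n n (ZG G)} {q : ℕ}
    (hC2 : ∀ j, j ≠ i₀ → C i₀ j = monomial (q + 1) (firstPass A i₀ q j)) {m : ℕ} (hm : 0 < m)
    (hmq : m ≤ q) (hne : pathSum C i₀ m i₀ ≠ 0) : C i₀ i₀ ≠ 0 := by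
  intro h0
  obtain ⟨m, rfl⟩ : ∃ c, m = c + 1 := ⟨m - 1, by omega⟩
  apply hne
  rw [pathSum_succ]
  refine Finset.sum_eq_zero fun e _ => Finset.sum_eq_zero fun l _ => ?_
  by_cases hl : l = i₀
  · rw [hl, h0, coeff_zero, mul_zero]
  · rw [pathSum_eq_zero hC2 _ (by omega) l hl, zero_mul]

/-- Follow a path to its first visit to `i₀` and divert its last edge to `a`. -/
theorem reflTransGen_of_pow_ne_zero {A : Matrix n n (ZG G)} {i₀ : n} {κ : Type*}
    {rel : κ ⊕ n → κ ⊕ n → Prop} {a : κ} (h1 : ∀ i j, i ≠ i₀ → A i j ≠ 0 → rel (.inr i) (.inr j))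
    (h2 : ∀ i, i ≠ i₀ → A i i₀ ≠ 0 → rel (.inr i) (.inl a)) (p : ℕ) (j : n) (hj : j ≠ i₀)
    (h : (A ^ p) j i₀ ≠ 0) : Relation.ReflTransGen rel (.inr j) (.inl a) := by
  induction p generalizing j with
  | zero => exact absurd (by rw [pow_zero, Matrix.one_apply_ne hj]) h
  | succ p ih =>
    rw [pow_succ', Matrix.mul_apply] at h
    obtain ⟨l, -, hl⟩ := Finset.exists_ne_zero_of_sum_ne_zero h
    by_cases hl0 : l = i₀
    · exact .single (h2 j hj (hl0 ▸ left_ne_zero_of_mul hl))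
    · exact .head (h1 j l hj (left_ne_zero_of_mul hl)) (ih l hl0 (right_ne_zero_of_mul hl))

/-- The hypotheses gather the numerical requirements: `hms` keeps the deleted loops longer than the
window that establishes growth, `hr2` makes the error at most half of the leading term, and `hr3`
makes the surviving half exceed the coefficients of `Q`. -/
theorem exists_extension [Nonempty k] {A : Matrix n n (ZG G)} (hA : GPrimitive A) {i₀ : n}
    (hi₀ : ∀ j, ∃ l, l ≠ i₀ ∧ A l j ≠ 0) {β γ : ℝ} (hβ : 0 < β) (hγ : 1 ≤ γ) (hβγ : β < γ) {m₀ : ℕ}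
    (hm₀ : 0 < m₀) (hAγ : ∀ m, m₀ ≤ m → ∀ g, γ ^ m ≤ (((A ^ m) i₀ i₀).coeff g : ℝ))
    {s : k → ℕ} (hs : Function.Injective s) (hms : ∀ a, 2 * m₀ ≤ s a) {g : k → G}
    (hg : ∀ a, 0 < (firstPass A i₀ (s a) i₀).coeff (g a)) {q : ℕ} (hsq : ∀ a, s a ≤ q) {r : ℕ}
    (hr : q + m₀ < r) (hr2 : Fintype.card k * (γ ^ q * ((β / γ) ^ r / (1 - β / γ))) ≤ 1 / 2)
    (hr3 : ∀ t, r ≤ t → ∀ a, β ^ t < 1 / 2 * γ ^ (t - 1 - s a)) {P Q : Matrix k k (ZG G)[X]}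
    (hP : P * (1 - Q) = 1) (hQ : ∀ i j m g, |((((Q i j).coeff m).coeff g : ℤ) : ℝ)| ≤ β ^ m)
    (hQr : ∀ i j, ∀ m < r, (Q i j).coeff m = 0) :
    ∃ B : Matrix (k ⊕ n) (k ⊕ n) (ZG G)[X],
      ElEquiv (Matrix.fromBlocks (1 - Q) 0 0 (1 - tMul A)) (1 - B) ∧ OverTPos B ∧
        GPrimitive (box B) ∧
          (Q.map augPoly = 0 → SSE {x : ℤ | 0 ≤ x} ((box B).map aug) (A.map aug)) := by
  have hγ0 : 0 < γ := one_pos.trans_le hγ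
  obtain ⟨a₀⟩ := ‹Nonempty k›
  have hmq : 2 * m₀ ≤ q := (hms a₀).trans (hsq a₀)
  set x : k → ZG G := fun a => MonoidAlgebra.single (g a) 1 with hx
  set C := deleteLoops A i₀ q s x with hCdef
  have hC : ∀ i j e, Nonneg ((C i j).coeff e) := nonneg_deleteLoops hA.1 hs hsq hg
  have hC0 : ∀ i j, (C i j).coeff 0 = 0 := coeff_deleteLoops_zero
  have hC1 : ∀ i j, i ≠ i₀ → C i j = monomial 1 (A i j) := fun i j => deleteLoops_apply_of_ne j
  have hC2 : ∀ j, j ≠ i₀ → C i₀ j = monomial (q + 1) (firstPass A i₀ q j) :=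
    fun j => deleteLoops_apply_exit
  have hC1' : ∀ i j e, i ≠ i₀ → e ≠ 0 → (C i j).coeff (e + 1) = 0 := by
    intro i j e hi he
    rw [hC1 i j hi, coeff_monomial, if_neg (by omega)]
  have hC2' : ∀ j e, j ≠ i₀ → e ≠ q → (C i₀ j).coeff (e + 1) = 0 := by
    intro j e hj he
    rw [hC2 j hj, coeff_monomial, if_neg (by omega)]
  have hCd : ∀ i j e, q + 1 < e → (C i j).coeff e = 0 := coeff_deleteLoops_eq_zero hsq
  have hz : ∀ m, m₀ ≤ m → ∀ g, γ ^ m ≤ ((pathSum C i₀ m i₀).coeff g : ℝ) := by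
    refine le_coeff_pathSum hC hγ0 hm₀ fun m h1 h2 g => ?_
    rw [pathSum_eq_pow hC2 (coeff_deleteLoops_of_lt hms hmq) hmq m h2]
    exact hAγ m h1 g
  obtain ⟨T, hT⟩ := exists_strictlyPos_pathSum hC hγ0 hz (exists_pathSum_ne_zero hA hi₀ hC hC1 hC2)
  set y : k → (ZG G)[X] := fun a => ∑ b, (1 - Q) a b * monomial (s b + 1) (x b) with hy
  have hlow : ∀ a t j h, 1 / 2 * ((if s a < t then pathSum C i₀ (t - 1 - s a) j else 0 : ZG G).coeff
      ((g a)⁻¹ * h) : ℝ) ≤ ((pathConv C i₀ (y a) t j).coeff h : ℝ) :=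
    half_le_coeff_pathConv hC hβ hγ hβγ hz hr hr2 hsq g hQ hQr
  have hR : ∀ a t j, Nonneg (pathConv C i₀ (y a) t j) := by
    intro a t j h
    have h1 := hlow a t j h
    have h2 : (0 : ℝ) ≤ ((if s a < t then pathSum C i₀ (t - 1 - s a) j else 0 : ZG G).coeff
        ((g a)⁻¹ * h) : ℝ) := by
      split_ifs
      · exact_mod_cast nonneg_pathSum hC _ _ _
      · simp
    have h3 : (0 : ℝ) ≤ ((pathConv C i₀ (y a) t j).coeff h : ℝ) := by linarith
    exact_mod_cast h3
  have hRpos : ∀ a t, T + q < t → ∀ j, pathConv C i₀ (y a) t j ≠ 0 := by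
    intro a t ht j
    have hsa := hsq a
    have h1 := hlow a t j 1
    rw [if_pos (by omega)] at h1
    have h2 : (0 : ℝ) < ((pathSum C i₀ (t - 1 - s a) j).coeff ((g a)⁻¹ * 1) : ℝ) := by
      exact_mod_cast hT (t - 1 - s a) (by omega) j _
    intro h0
    rw [h0, MonoidAlgebra.coeff_zero, Finsupp.zero_apply, Int.cast_zero] at h1
    linarith
  have hRloop : ∀ a t, r ≤ t → ∀ h, β ^ t < ((pathConv C i₀ (y a) t i₀).coeff h : ℝ) := by
    intro a t ht h
    have hsa := hsq a
    have h1 := hlow a t i₀ h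
    rw [if_pos (by omega)] at h1
    have h2 := hz (t - 1 - s a) (by omega) ((g a)⁻¹ * h)
    have h3 := hr3 t ht a
    linarith
  obtain ⟨dy, hdy⟩ := exists_coeff_bound (Matrix.of fun (a : k) (_ : Unit) => y a)
  obtain ⟨dQ, hdQ⟩ := exists_coeff_bound Q
  -- Large enough that `N - q` exceeds the degrees of `y` and `Q`, that the path counts of length
  -- `N` are nonzero, and that degrees `r` and `r + 1` lie in the untruncated range.
  obtain ⟨N, hN⟩ : ∃ N, N = q + dy + dQ + r + T + q + 2 := ⟨_, rfl⟩
  have hyN : ∀ a e, N - q < e → (y a).coeff e = 0 := fun a e he => hdy a () e (by omega)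
  have hy0 : ∀ a, (y a).coeff 0 = 0 := by
    intro a
    rw [hy, finsetSum_coeff]
    refine Finset.sum_eq_zero fun b _ => ?_
    rw [mul_coeff_zero, coeff_monomial, if_neg (by omega), mul_zero]
  set ρ := truncPaths C i₀ q N y with hρdef
  have hρ : ∀ a j e, Nonneg ((ρ a j).coeff e) := by
    intro a j e
    rw [coeff_truncPaths]
    split_ifs <;> first | exact hR _ _ _ | exact Nonneg.zero
  have hρC := coeff_matrix_mul_nonneg_zg hρ hC
  have hsum : ∀ a j e, e ≤ N + 1 → (j = i₀ → e ≤ N - q + 1) →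
      ((startEdges i₀ y + ρ * C : Matrix k n (ZG G)[X]) a j).coeff e = pathConv C i₀ (y a) e j :=
    fun a j e => coeff_startEdges_add hC0 hC2' a j e
  have hsum' : ∀ a j e, N - q < e →
      ((startEdges i₀ y + ρ * C : Matrix k n (ZG G)[X]) a j).coeff e = ((ρ * C) a j).coeff e := by
    intro a j e he
    rw [Matrix.add_apply, coeff_add, coeff_startEdges, hyN a e he, ite_self, zero_add]
  have hτ := coeff_startEdges_sub_eq (N := N) hC0 hC2' hyN
  rw [← hρdef] at hτ
  have hτnn : ∀ a j e,
      Nonneg (((startEdges i₀ y - ρ * (1 - C) : Matrix k n (ZG G)[X]) a j).coeff e) := by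
    intro a j e
    rw [hτ]
    split_ifs <;> first | exact hρC _ _ _ | exact Nonneg.zero
  have htop : ∀ a j e, N + 1 < e → ((ρ * C) a j).coeff e = 0 := fun a j e =>
    coeff_truncPaths_mul_eq_zero (by omega) hC0 hC1' hCd a j e
  -- Degree `N + 1` is attained by a path of length `N` to a predecessor `l ≠ i₀` of `j`, followed
  -- by an edge of length one. This is the reason for the choice of `i₀`.
  have htop' : ∀ a j, ((ρ * C) a j).coeff (N + 1) ≠ 0 := by
    intro a j
    obtain ⟨l, hl, hlj⟩ := hi₀ j
    rw [coeff_matrix_mul_of_coeff_zero hC0]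
    have hnn : ∀ e l, Nonneg ((ρ a l).coeff (N + 1 - 1 - e) * (C l j).coeff (e + 1)) :=
      fun e l => (hρ _ _ _).mul (hC _ _ _)
    refine Nonneg.sum_ne_zero (i := 0) (fun e _ => Nonneg.sum fun l _ => hnn e l) (by simp)
      (Nonneg.sum_ne_zero (i := l) (fun l _ => hnn 0 l) (Finset.mem_univ l) ?_)
    refine (hρ _ _ _).mul_ne_zero (hC _ _ _) ?_ ?_
    · rw [coeff_truncPaths, if_neg hl, if_pos (by omega)]
      exact hRpos a _ (by omega) l
    · rw [hC1 l j hl, coeff_monomial, if_pos rfl]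
      exact hlj
  set S : Matrix n k (ZG G)[X] := (rowOnes k i₀ : Matrix n k (ZG G)).map Polynomial.C with hS
  set B : Matrix (k ⊕ n) (k ⊕ n) (ZG G)[X] :=
    Matrix.fromBlocks (Q + (startEdges i₀ y + ρ * C) * S) (startEdges i₀ y - ρ * (1 - C))
      (C * S) C with hB
  have hB11 : ∀ a b e, (B (.inl a) (.inl b)).coeff e = (Q a b).coeff e +
      ((startEdges i₀ y + ρ * C : Matrix k n (ZG G)[X]) a i₀).coeff e := by
    intro a b e
    rw [hB, Matrix.fromBlocks_apply₁₁, Matrix.add_apply, coeff_add, mul_rowOnes]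
  have hB12 : ∀ a j, B (.inl a) (.inr j) =
    (startEdges i₀ y - ρ * (1 - C) : Matrix k n (ZG G)[X]) a j := fun a j => rfl
  have hB21 : ∀ i b, B (.inr i) (.inl b) = C i i₀ := fun i b => mul_rowOnes C i₀ i b
  have hB22 : ∀ i j, B (.inr i) (.inr j) = C i j := fun i j => rfl
  have hBloop : ∀ a b e, r ≤ e → e ≤ N - q + 1 → StrictlyPos ((B (.inl a) (.inl b)).coeff e) := by
    intro a b e h1 h2 h
    rw [hB11, hsum a i₀ e (by omega) (fun _ => h2), MonoidAlgebra.coeff_add, Finsupp.add_apply]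
    have h3 := hRloop a e h1 h
    have h4 := (abs_le.1 (hQ a b e h)).1
    have h5 : (0 : ℝ) < (((Q a b).coeff e).coeff h : ℝ) +
        ((pathConv C i₀ (y a) e i₀).coeff h : ℝ) := by linarith
    exact_mod_cast h5
  have hBover : OverTPos B := by
    rintro (a | i) (b | j)
    · refine ⟨?_, fun e => ?_⟩
      · rw [hB11, hQr _ _ _ (by omega), zero_add, Matrix.add_apply, coeff_add, coeff_startEdges,
          hy0,
          ite_self, zero_add, coeff_matrix_mul_of_coeff_zero hC0, Finset.range_zero,
          Finset.sum_empty]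
      · rcases le_or_gt e (N - q + 1) with h1 | h1
        · rcases le_or_gt r e with h2 | h2
          · exact (hBloop a b e h2 h1).nonneg
          · rw [hB11, hQr _ _ _ h2, zero_add, hsum a i₀ e (by omega) fun _ => h1]
            exact hR _ _ _
        · rw [hB11, hdQ _ _ _ (by omega), zero_add, hsum' a i₀ e (by omega)]
          exact hρC _ _ _
    · rw [hB12]
      refine ⟨?_, hτnn a j⟩
      rw [hτ, if_pos (Nat.zero_le _)]
    · rw [hB21]
      exact ⟨hC0 _ _, hC _ _⟩
    · exact ⟨hC0 _ _, hC _ _⟩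
  have hBd : ∀ i j e, N + 1 < e → (B i j).coeff e = 0 := by
    rintro (a | i) (b | j) e he
    · rw [hB11, hdQ _ _ _ (by omega), zero_add, hsum' a i₀ e (by omega), htop _ _ _ he]
    · rw [hB12, hτ, htop _ _ _ he, ite_self]
    · rw [hB21]
      exact hCd _ _ _ (by omega)
    · exact hCd _ _ _ (by omega)
  have hBtop : ∀ a j, (B (.inl a) j).coeff (N + 1) ≠ 0 := by
    rintro a (b | j)
    · rw [hB11, hdQ _ _ _ (by omega), zero_add, hsum' a i₀ _ (by omega)]
      exact htop' _ _
    · rw [hB12, hτ, if_neg (by split_ifs <;> omega)]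
      exact htop' _ _
  have hdeg : polyDegree B = N + 1 := polyDegree_eq B (N + 1) (by omega) hBd (hBtop a₀ (.inl a₀))
  have hne : ∀ {i j e}, (B i j).coeff e ≠ 0 → B i j ≠ 0 := by
    intro i j e h h0
    rw [h0, coeff_zero] at h
    exact h rfl
  have hstart : (1 - Q) * loopEdges i₀ s x = startEdges i₀ y := by
    ext1 a j
    rw [mul_loopEdges]
    rfl
  refine ⟨B, ?_, hBover, gprimitive_box_of_eq hdeg ?_, fun hQ0 => sse_box_of_eq hdeg ?_⟩
  · obtain ⟨E, hE, hEA⟩ := exists_El_expandRow A i₀ q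
    have h := ElEquiv.of_blocks hE hEA hP (loopEdges i₀ s x) ρ S (C := C) rfl
    rwa [hstart] at h
  -- The loop at a new vertex has strictly positive coefficients in the consecutive degrees `r` and
  -- `r + 1`, and its row has all top coefficients nonzero.
  · refine gprimitive_boxL hBover (N + 1) hBd (.inl a₀) r (by omega)
      (hBloop _ _ _ le_rfl (by omega)) (hBloop _ _ _ (by omega) (by omega)) ?_ (hBtop a₀)
    have hmon : ∀ {i j}, i ≠ i₀ → A i j ≠ 0 → C i j ≠ 0 := by
      intro i j hi h
      rw [hC1 i j hi, Ne, monomial_eq_zero_iff]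
      exact h
    rintro (a | j)
    · exact .single (hne (hBtop a (.inl a₀)))
    · by_cases hj : j = i₀
      · refine .single ?_
        rw [hB21, hj]
        -- Every edge of `C` into `i₀` has a copy into each new vertex, so from `i₀` itself one
        -- needs a loop that was not deleted. Closed paths of length `m₀ ≤ q` exist and consist of
        -- such loops.
        refine exists_loop_ne_zero hC2 hm₀ (by omega) fun h0 => ?_
        have h1 := hz m₀ le_rfl 1
        rw [h0, MonoidAlgebra.coeff_zero, Finsupp.zero_apply, Int.cast_zero] at h1
        exact absurd h1 (not_le.2 (by positivity))
      · obtain ⟨p, -, hp⟩ := hA.2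
        refine reflTransGen_of_pow_ne_zero (A := A) (i₀ := i₀) (fun i j hi h => ?_)
          (fun i hi h => ?_) p j hj (hp _ _).ne_zero
        · exact hmon hi h
        · rw [hB21]
          exact hmon hi h
  · have hco : ∀ {l l' : Type} (M : Matrix l l' (ZG G)[X]) i j e,
        (M.map augPoly i j).coeff e = aug ((M i j).coeff e) := fun M i j e => coeff_map _ _
    have hYmap : (startEdges i₀ y).map augPoly = (loopEdges i₀ s x).map augPoly := by
      rw [← hstart, Matrix.map_mul, Matrix.map_sub _ (map_sub _), hQ0,
        Matrix.map_one _ (map_zero _) (map_one _), sub_zero, Matrix.one_mul]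
    have hSmap : S.map augPoly = (rowOnes k i₀ : Matrix n k ℤ).map Polynomial.C := by
      ext1 i a
      by_cases hi : i = i₀ <;> simp [hS, rowOnes, hi]
    have hτmap : (startEdges i₀ y - ρ * (1 - C)).map augPoly =
        (loopEdges i₀ s x).map augPoly - ρ.map augPoly * (1 - C.map augPoly) := by
      rw [Matrix.map_sub _ (map_sub _), Matrix.map_mul, Matrix.map_sub _ (map_sub _),
        Matrix.map_one _ (map_zero _) (map_one _), hYmap]
    have hBmap : B.map augPoly = pathBlocks ((loopEdges i₀ s x).map augPoly) (ρ.map augPoly)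
        ((rowOnes k i₀ : Matrix n k ℤ).map Polynomial.C) (C.map augPoly) := by
      rw [hB, Matrix.fromBlocks_map, hτmap, Matrix.map_add _ (map_add _), hQ0, zero_add,
        Matrix.map_mul, Matrix.map_mul, Matrix.map_add _ (map_add _), Matrix.map_mul, hYmap, hSmap]
      rfl
    have hyx : ∀ a j e, Nonneg ((loopEdges i₀ s x a j).coeff e) := by
      intro a j e
      simp only [loopEdges, Matrix.of_apply]
      split_ifs
      · rw [coeff_monomial]
        split_ifs
        · exact Nonneg.single _ zero_le_one
        · exact Nonneg.zero
      · exact Nonneg.zero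
    rw [hBmap]
    refine sse_pathBlocks (A.map aug) (fun i j => (hA.1 i j).aug_nonneg) i₀ q (N + 1) _ _ _ _
      ?_ ?_ ?_ ?_ ?_ ?_ ?_ ?_ ?_ ?_
    · intro i j e
      rw [hco]
      exact (hyx _ _ _).aug_nonneg
    · intro i j
      rw [hco]
      by_cases hj : j = i₀
      · rw [loopEdges, Matrix.of_apply, if_pos hj, coeff_monomial, if_neg (by omega), map_zero]
      · rw [loopEdges, Matrix.of_apply, if_neg hj, coeff_zero, map_zero]
    · intro i j e
      rw [hco]
      exact (hρ _ _ _).aug_nonneg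
    · intro i j
      rw [hco, coeff_truncPaths, if_pos (Nat.zero_le _), pathConv]
      simp [hy0]
    · intro i j e
      rw [hco]
      exact (hC _ _ _).aug_nonneg
    · intro i j
      rw [hco, hC0, map_zero]
    · intro i j
      simp only [rowOnes, Matrix.of_apply]
      split_ifs <;> simp
    · intro i j e
      rw [← hτmap, hco]
      exact (hτnn _ _ _).aug_nonneg
    · have h1 : expandRow A i₀ q = S * loopEdges i₀ s x + C := by
        rw [hCdef, deleteLoops, add_sub_cancel]
      rw [← map_expandRow, h1, ← hSmap]
      show (S * loopEdges i₀ s x + C).map augPoly = _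
      rw [Matrix.map_add _ (map_add _), Matrix.map_mul]
    · intro i j e he
      rw [← hBmap, hco, hBd _ _ _ he, map_zero]

end Extension

/-! ### The bound on `r`. -/

section Threshold

/-- Both inequalities hold for large `r` since `(β / γ)^r` tends to zero; the shift of the exponent
by `1 + d ≤ q + 1` costs only a constant factor. -/
theorem exists_threshold {β γ : ℝ} (hβ : 1 < β) (hβγ : β < γ) (k q : ℕ) :
    ∃ r₀ : ℕ, ∀ r, r₀ ≤ r → (k : ℝ) * (γ ^ q * ((β / γ) ^ r / (1 - β / γ))) ≤ 1 / 2 ∧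
      ∀ d, d ≤ q → β ^ r < 1 / 2 * γ ^ (r - 1 - d) := by
  have hβ0 : 0 < β := one_pos.trans hβ
  have hγ0 : 0 < γ := hβ0.trans hβγ
  have h1 : Filter.Tendsto (fun r : ℕ => (k : ℝ) * (γ ^ q * ((β / γ) ^ r / (1 - β / γ))))
      Filter.atTop (nhds (k * (γ ^ q * (0 / (1 - β / γ))))) :=
    (((tendsto_pow_atTop_nhds_zero_of_lt_one (by positivity)
      ((div_lt_one hγ0).2 hβγ)).div_const _).const_mul _).const_mul _
  rw [zero_div, mul_zero, mul_zero] at h1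
  have h2 := (tendsto_pow_atTop_atTop_of_one_lt ((one_lt_div hβ0).2 hβγ)).eventually_gt_atTop
    (2 * γ ^ (q + 1))
  obtain ⟨r₀, hr₀⟩ := Filter.eventually_atTop.1
    ((h1.eventually_le_const (show (0 : ℝ) < 1 / 2 by norm_num)).and h2)
  refine ⟨r₀, fun r hr => ⟨(hr₀ r hr).1, fun d hd => ?_⟩⟩
  have h3 := (hr₀ r hr).2
  rw [div_pow, lt_div_iff₀ (by positivity)] at h3
  have h4 : γ ^ r ≤ γ ^ (q + 1) * γ ^ (r - 1 - d) := by
    rw [← pow_add]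
    exact pow_le_pow_right₀ (hβ.trans hβγ).le (by omega)
  have h5 : γ ^ (q + 1) * (2 * β ^ r) < γ ^ (q + 1) * γ ^ (r - 1 - d) := by linarith
  have h6 := lt_of_mul_lt_mul_left h5 (by positivity)
  linarith

end Threshold

end GExt

end

open GExt in
theorem proposition5p4 {G : Type*} [Group G] [Finite G]
    (n : ℕ) (hn : 1 < n) (A : Matrix (Fin n) (Fin n) (ZG G)) (hA : GPrimitive A)
    (β : ℝ) (hβ : 1 < β) (hβA : β < specRadius A) (k : ℕ) :
    ∃ r₀ : ℕ, 0 < r₀ ∧ ∀ r : ℕ, r₀ ≤ r → ∀ Q : Matrix (Fin k) (Fin k) (ZG G)[X],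
      IsUnit (1 - Q) →
      (∀ i j s g, |((((Q i j).coeff s).coeff g : ℤ) : ℝ)| ≤ β ^ s) →
      (∀ i j, ∀ s < r, (Q i j).coeff s = 0) →
      ∃ B : Matrix (Fin k ⊕ Fin n) (Fin k ⊕ Fin n) (ZG G)[X],
        ElEquiv (Matrix.fromBlocks (1 - Q) 0 0 (1 - tMul A)) (1 - B) ∧
        OverTPos B ∧
        GPrimitive (box B) ∧
        (Q.map augPoly = 0 → SSE {x : ℤ | 0 ≤ x} ((box B).map aug) (A.map aug)) := by
  have := Fintype.ofFinite G
  have : Nontrivial (Fin n) := Fin.nontrivial_iff_two_le.2 hn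
  obtain ⟨i₀, hi₀⟩ := hA.exists_not_unique_pred
  rcases Nat.eq_zero_or_pos k with rfl | hk
  · refine ⟨1, one_pos, fun r _ Q _ _ _ => ?_⟩
    obtain ⟨B, h1, h2, h3, h4⟩ := exists_extension_of_isEmpty hA i₀ Q
    exact ⟨B, h1, h2, h3, fun _ => h4⟩
  · have : Nonempty (Fin k) := ⟨⟨0, hk⟩⟩
    obtain ⟨γ, hβγ, m₀, hm₀⟩ := hA.exists_growth (one_pos.trans hβ) hβA
    -- `m₀ + 1` replaces `m₀` because the growth window must start at a positive length.
    obtain ⟨s, hs, hms, g, hg⟩ := hA.exists_loops hi₀ k (2 * (m₀ + 1))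
    have hsq : ∀ a, s a ≤ ∑ a, s a := fun a =>
      Finset.single_le_sum (fun _ _ => Nat.zero_le _) (Finset.mem_univ a)
    obtain ⟨r₀, hr₀⟩ := exists_threshold hβ hβγ k (∑ a, s a)
    -- The sum of the `s a` serves as `q`, being an upper bound for all of them. It depends on `A`,
    -- `β` and `k` only, so `r` may be taken large after it.
    refine ⟨r₀ + ∑ a, s a + (m₀ + 1) + 1, by omega, fun r hr Q hQu hQ hQr => ?_⟩
    obtain ⟨P, hP⟩ := hQu.exists_left_inv
    refine exists_extension hA hi₀ (one_pos.trans hβ) (hβ.trans hβγ).le hβγ (Nat.succ_pos m₀)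
      (fun m hm g => hm₀ m (by omega) i₀ i₀ g) hs hms hg hsq (by omega) ?_
      (fun t ht a => (hr₀ t (by omega)).2 _ (hsq a)) hP hQ hQr
    rw [Fintype.card_fin]
    exact (hr₀ r (by omega)).1
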